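/- **Setting.** Let $\underline n=(n_1,\dots,n_r)$ be a tuple of positive integers and let $\theta=\{\theta_{ij}:1\le i<j\le r\}$ be a permutation set for $\underline n$: each $\theta_{ij}$ is a permutation of the index pairs $(k,l)$, $1\le k\le n_i$, $1\le l\le n_j$. Let $\mathbb F_\theta^+$ be the universal unital semigroup with generators $e_{ik}$ ($1\le i\le r$, $1\le k\le n_i$) subject to the relations $e_{ik}e_{jl}=e_{jl'}e_{ik'}$ whenever $i<j$ and $\theta_{ij}(k,l)=(k',l')$. Call $\theta$ *cancelative* if $\mathbb F_\theta^+$ is left and right cancelative. In that case let $L_v\xi_w=\xi_{vw}$ be the left shift isometries on the Fock space $\mathcal H_\theta=\ell^2(\mathbb F_\theta^+)$ with orthonormal basis $\{\xi_w\}$, and let $\mathcal A_\theta$ and $\mathfrak L_\theta$ be the norm closed, respectively weak operator topology closed, algebras generated by $\{L_w: w\in\mathbb F^+_\theta\}$. An algebra homomorphism between two such algebras is *graded* if it maps each $L_{e_{ik}}$ to a linear combination of the $L_e$ with $e$ a generator. A graded homomorphism is *multi-graded* if, for some bijection $\sigma$ between the sets of block indices, it maps each $L_{e_{ik}}$ to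 a linear combination of the operators $L_{e_{\sigma(i)l}}$, $l=1,2,\dots$. Two algebras are *(multi-)gradedly isometrically isomorphic* if there is an isometric algebra isomorphism of the first onto the second that is (multi-)graded. For a permutation $\rho$ of a finite set, $\pi(\rho)$ denotes the unitary with $\pi(\rho)e_x=e_{\rho(x)}$. **Theorem 7.1.** Let $\theta$ and $\tau$ be cancelative permutation sets for tuples $\underline n=(n_1,\dots,n_r)$ and $\underline m=(m_1,\dots,m_s)$ of positive integers. The following are equivalent. (i) $\mathcal A_\theta$ and $\mathcal A_\tau$ are gradedly isometrically isomorphic. (i') $\mathcal A_\theta$ and $\mathcal A_\tau$ are multi-gradedly isometrically isomorphic. (ii) $\mathfrak L_\theta$ and $\mathfrak L_\tau$ are gradedly isometrically isomorphic. (ii') $\mathfrak L_\theta$ and $\mathfrak L_\tau$ are multi-gradedly isometrically isomorphic. (iii) After relabeling the generators of $\mathbb F_\tau^+$ (by a bijection $\sigma$ from the blocks of $\theta$ to the blocks of $\tau$ and bijections from the generators of block $i$ to those of block $\sigma(i)$, so that $r=s$ and $m_{\sigma(i)}=n_i$, with the relations of $\tau$ rewritten in the new order of the blocks as a permutation set for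 $\underline n$, again denoted $\tau$), there are unitary matrices $A_i=(a^{(i)}_{kl})\in M_{n_i}(\mathbb C)$, $1\le i\le r$, such that $$\pi(\theta_{ij})=(A_i\otimes A_j)\,\pi(\tau_{ij})\,(A_i\otimes A_j)^*\qquad(1\le i<j\le r),$$ and there is a unitary operator $U=U_{A_1,\dots,A_r}=\sum_{p\in\mathbb Z_+^r}A_1^{\otimes p_1}\otimes\dots\otimes A_r^{\otimes p_r}$ from $\mathcal H_\theta$ to $\mathcal H_\tau$ such that $X\mapsto UXU^*$ maps $\mathfrak L_\theta$ onto $\mathfrak L_\tau$. Here $U_{A_1,\dots,A_r}$ is determined as follows: for words $w_i=e_{i,k^i_1}\cdots e_{i,k^i_{p_i}}$ in the generators of block $i$, $$U\,\xi_{w_1w_2\cdots w_r}=\sum_{l}\Big(\prod_{i=1}^r\prod_{t=1}^{p_i}a^{(i)}_{k^i_t\,l^i_t}\Big)\,\xi_{w_1'w_2'\cdots w_r'},\qquad w_i'=e_{i,l^i_1}\cdots e_{i,l^i_{p_i}},$$ where the sum is over all choices of indices $l^i_t\in\{1,\dots,n_i\}$. -/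

import Mathlib

open scoped Kronecker Matrix lp

noncomputable section

namespace HigherRankToeplitz

/-! ### Permutation sets and their semigroups -/

/-- A permutation set for the tuple `n = (n₁, …, n_r)`: for all `i < j` a permutation `θ_{ij}` of
the index pairs `(k, l)` of the formal products `e_{ik} e_{jl}`. -/
abbrev PermSet {r : ℕ} (n : Fin r → ℕ) : Type :=
  ∀ i j : Fin r, i < j → Equiv.Perm (Fin (n i) × Fin (n j))

/-- The index set of the generators `e_{ik}`, `1 ≤ k ≤ n_i`, `1 ≤ i ≤ r`. -/
abbrev Gen {r : ℕ} (n : Fin r → ℕ) : Type := Σ i : Fin r, Fin (n i)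

/-- The commutation relations of `θ`: if `θ_{ij} (k, l) = (k', l')` then
`e_{ik} e_{jl} = e_{jl'} e_{ik'}`. -/
inductive Rel {r : ℕ} {n : Fin r → ℕ} (θ : PermSet n) :
    FreeMonoid (Gen n) → FreeMonoid (Gen n) → Prop
  | comm (i j : Fin r) (h : i < j) (k : Fin (n i)) (l : Fin (n j)) :
      Rel θ (FreeMonoid.of ⟨i, k⟩ * FreeMonoid.of ⟨j, l⟩)
        (FreeMonoid.of ⟨j, (θ i j h (k, l)).2⟩ * FreeMonoid.of ⟨i, (θ i j h (k, l)).1⟩)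

/-- The unital semigroup `𝔽_θ⁺`: the universal monoid with generators `e_{ik}` subject to the
commutation relations of `θ`. -/
abbrev Semi {r : ℕ} {n : Fin r → ℕ} (θ : PermSet n) : Type := PresentedMonoid (Rel θ)

/-- The generator `e_{ik}` of `𝔽_θ⁺`. -/
def gen {r : ℕ} {n : Fin r → ℕ} (θ : PermSet n) (i : Fin r) (k : Fin (n i)) : Semi θ :=
  PresentedMonoid.of (Rel θ) ⟨i, k⟩

/-- `θ` is a cancelative permutation set: the semigroup `𝔽_θ⁺` is left and right cancelative. -/
abbrev Cancelative {r : ℕ} {n : Fin r → ℕ} (θ : PermSet n) : Prop := IsCancelMul (Semi θ)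

/-! ### Fock space, left regular representation, and the two operator algebras -/

/-- The Fock space `H_S = ℓ²(S)`. -/
abbrev Fock (S : Type) : Type := ℓ²(S, ℂ)

/-- The standard orthonormal basis vector `ξ_w` of the Fock space. -/
def ξ {S : Type} (w : S) : Fock S :=
  haveI := Classical.decEq S
  lp.single 2 w (1 : ℂ)

theorem orthonormal_ξ {S : Type} : Orthonormal ℂ (ξ : S → Fock S) := by
  classical
  rw [orthonormal_iff_ite]
  intro v w
  unfold ξ
  rw [lp.inner_single_left, lp.single_apply]
  by_cases h : v = w
  · subst h; simp
  · simp [h]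

theorem orthonormal_ξ_mul {S : Type} [Monoid S] [IsLeftCancelMul S] (v : S) :
    Orthonormal ℂ (fun w : S => (ξ (v * w) : Fock S)) :=
  orthonormal_ξ.comp (fun w => v * w) (mul_right_injective v)

/-- The left shift `L_v` on the Fock space, the isometry with `L_v ξ_w = ξ_{vw}`. -/
def shift {S : Type} [Monoid S] [IsLeftCancelMul S] (v : S) : Fock S →L[ℂ] Fock S :=
  (orthonormal_ξ_mul v).orthogonalFamily.linearIsometry.toContinuousLinearMap

theorem shift_ξ {S : Type} [Monoid S] [IsLeftCancelMul S] (v w : S) :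
    shift v (ξ w : Fock S) = ξ (v * w) := by
  classical
  have h := (orthonormal_ξ_mul v).orthogonalFamily.linearIsometry_apply_single (i := w) (1 : ℂ)
  have e : (ξ w : Fock S) = lp.single 2 w (1 : ℂ) := by unfold ξ; congr!
  rw [shift, LinearIsometry.coe_toContinuousLinearMap, e]
  convert h using 1
  simp

/-- The norm closed operator algebra `𝒜_S` on Fock space generated by the left shifts. -/
def normAlg (S : Type) [Monoid S] [IsLeftCancelMul S] : Subalgebra ℂ (Fock S →L[ℂ] Fock S) :=
  (Algebra.adjoin ℂ (Set.range (shift : S → Fock S →L[ℂ] Fock S))).topologicalClosure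

/-- The operator algebra `𝔏_S` on Fock space generated by the left shifts as an algebra that is
closed in the weak operator topology: the smallest WOT closed algebra that contains them. -/
def wotAlg (S : Type) [Monoid S] [IsLeftCancelMul S] : Subalgebra ℂ (Fock S →L[ℂ] Fock S) :=
  sInf {B | (∀ v : S, shift v ∈ B) ∧ IsClosed {Y : Fock S →WOT[ℂ] Fock S | Y.toCLM ∈ B}}

theorem shift_mem_normAlg {S : Type} [Monoid S] [IsLeftCancelMul S] (v : S) : shift v ∈ normAlg S :=
  Subalgebra.le_topologicalClosure _ (Algebra.subset_adjoin ⟨v, rfl⟩)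

theorem shift_mem_wotAlg {S : Type} [Monoid S] [IsLeftCancelMul S] (v : S) : shift v ∈ wotAlg S := by
  rw [wotAlg, Algebra.mem_sInf]
  exact fun B hB => hB.1 v

/-! ### Graded and multi-graded isometric isomorphisms -/

section Graded

variable {r s : ℕ} {n : Fin r → ℕ} {m : Fin s → ℕ} {θ : PermSet n} {τ : PermSet m}
  [IsLeftCancelMul (Semi θ)] [IsLeftCancelMul (Semi τ)]
  {B : Subalgebra ℂ (Fock (Semi θ) →L[ℂ] Fock (Semi θ))}
  {C : Subalgebra ℂ (Fock (Semi τ) →L[ℂ] Fock (Semi τ))}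

/-- An algebra homomorphism is graded if it maps each generating isometry `L_e`, `e` of total
degree one, to a linear combination of such generators. -/
def IsGraded (Φ : B →ₐ[ℂ] C) : Prop :=
  ∀ (i : Fin r) (k : Fin (n i)) (X : B), (X : Fock (Semi θ) →L[ℂ] Fock (Semi θ)) =
      shift (gen θ i k) →
    (Φ X : Fock (Semi τ) →L[ℂ] Fock (Semi τ)) ∈
      Submodule.span ℂ {Y | ∃ (j : Fin s) (l : Fin (m j)), Y = shift (gen τ j l)}

/-- A graded homomorphism is multi-graded if it respects the multi-gradings up to a reordering
`σ` of the sets of generators: generators of multi-degree `δ_i` go to linear combinations of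
generators of multi-degree `δ_{σ i}`. -/
def IsMultigraded (Φ : B →ₐ[ℂ] C) : Prop :=
  IsGraded Φ ∧ ∃ σ : Fin r ≃ Fin s,
    ∀ (i : Fin r) (k : Fin (n i)) (X : B), (X : Fock (Semi θ) →L[ℂ] Fock (Semi θ)) =
        shift (gen θ i k) →
      (Φ X : Fock (Semi τ) →L[ℂ] Fock (Semi τ)) ∈
        Submodule.span ℂ {Y | ∃ l : Fin (m (σ i)), Y = shift (gen τ (σ i) l)}

variable (B C)

/-- `B` and `C` are gradedly isometrically isomorphic. -/
def GradedlyIsometricallyIsomorphic : Prop :=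
  ∃ Φ : B ≃ₐ[ℂ] C, Isometry Φ ∧ IsGraded Φ.toAlgHom

/-- `B` and `C` are multi-gradedly isometrically isomorphic. -/
def MultigradedlyIsometricallyIsomorphic : Prop :=
  ∃ Φ : B ≃ₐ[ℂ] C, Isometry Φ ∧ IsMultigraded Φ.toAlgHom

end Graded

/-! ### Product unitary equivalence and the unitaries `U_{A₁, …, A_r}` -/

/-- The relations of `τ` between the `i`-th and `j`-th sets of generators, `i ≠ j` in either order,
as a permutation `ρ` such that `e_{ik} e_{jl} = e_{jl'} e_{ik'}` when `ρ (k, l) = (k', l')`. -/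
def PermSet.perm {s : ℕ} {m : Fin s → ℕ} (τ : PermSet m) (i j : Fin s) (hij : i ≠ j) :
    Equiv.Perm (Fin (m i) × Fin (m j)) :=
  if h : i < j then τ i j h
  else (Equiv.prodComm _ _).trans
    ((τ j i (lt_of_le_of_ne (not_lt.mp h) hij.symm)).symm.trans (Equiv.prodComm _ _))

/-- A relabeling of generators: a bijection `σ` between the sets of generators, and bijections
between the generators in the `i`-th set and those in the `σ i`-th set. -/
structure Relabeling {r s : ℕ} (n : Fin r → ℕ) (m : Fin s → ℕ) where
  σ : Fin r ≃ Fin s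
  ι : ∀ i, Fin (n i) ≃ Fin (m (σ i))

/-- The permutation set `τ` relabeled, with generators `e_{ik} := e_{σ i, ι_i k}`. -/
def PermSet.relabel {r s : ℕ} {n : Fin r → ℕ} {m : Fin s → ℕ} (τ : PermSet m)
    (R : Relabeling n m) : PermSet n := fun i j h =>
  (Equiv.prodCongr (R.ι i) (R.ι j)).symm.permCongr
    (τ.perm (R.σ i) (R.σ j) (R.σ.injective.ne h.ne))

/-- The permutation unitary `π(ρ)`, `π(ρ) e_x = e_{ρ x}`. -/
def permUnitary {X : Type} [DecidableEq X] (ρ : Equiv.Perm X) : Matrix X X ℂ :=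
  Matrix.of fun y x => if y = ρ x then 1 else 0

/-- The unitary matrices `A₁, …, A_r` implement the product unitary equivalences
`π(θ_{ij}) = (A_i ⊗ A_j) π(τ_{ij}) (A_i ⊗ A_j)*`. -/
def ImplementsProductEquiv {r : ℕ} {n : Fin r → ℕ} (θ τ : PermSet n)
    (A : ∀ i, Matrix.unitaryGroup (Fin (n i)) ℂ) : Prop :=
  ∀ (i j : Fin r) (h : i < j),
    permUnitary (θ i j h) =
      ((A i).1 ⊗ₖ (A j).1) * permUnitary (τ i j h) * ((A i).1 ⊗ₖ (A j).1)ᴴ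

/-- The element `w₁ w₂ ⋯ w_r` of `𝔽_θ⁺`, where `w_i` is the word of length `p_i` in the `i`-th
generators with letters `e_{i, w i t}`. -/
def word {r : ℕ} {n : Fin r → ℕ} (θ : PermSet n) {p : Fin r → ℕ}
    (w : ∀ i, Fin (p i) → Fin (n i)) : Semi θ :=
  (List.ofFn fun i => (List.ofFn fun t => gen θ i (w i t)).prod).prod

/-- The element `w₁ w₂ ⋯ w_r` of `𝔽_τ⁺`, where `w_i` is a word in the relabeled `i`-th generators
`e_{σ i, ι_i k}` of `𝔽_τ⁺`. -/
def relabeledWord {r s : ℕ} {n : Fin r → ℕ} {m : Fin s → ℕ} (τ : PermSet m) (R : Relabeling n m)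
    {p : Fin r → ℕ} (w : ∀ i, Fin (p i) → Fin (n i)) : Semi τ :=
  (List.ofFn fun i => (List.ofFn fun t => gen τ (R.σ i) (R.ι i (w i t))).prod).prod

/-- `U` is the operator `U_{A₁, …, A_r} = ∑_p A₁^{⊗ p₁} ⊗ ⋯ ⊗ A_r^{⊗ p_r}` from the Fock space of
`𝔽_θ⁺` to the Fock space of `𝔽_τ⁺` (relabeled). In each multi-degree `p`, the basis vector of the
factored word `w₁ ⋯ w_r` is read as the tensor `w₁ ⊗ ⋯ ⊗ w_r` of `⨂_i (ℂ^{n_i})^{⊗ p_i}`, and `A_i`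
acts on `ℂ^{n_i}` by `e_{ik} ↦ ∑_l (A_i)_{kl} e_{il}`. -/
def IsProductUnitary {r s : ℕ} {n : Fin r → ℕ} {m : Fin s → ℕ} (θ : PermSet n) (τ : PermSet m)
    (R : Relabeling n m) (A : ∀ i, Matrix.unitaryGroup (Fin (n i)) ℂ)
    (U : Fock (Semi θ) ≃ₗᵢ[ℂ] Fock (Semi τ)) : Prop :=
  ∀ (p : Fin r → ℕ) (w : ∀ i, Fin (p i) → Fin (n i)),
    U (ξ (word θ w)) =
      ∑ w' : (∀ i, Fin (p i) → Fin (n i)),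
        (∏ i, ∏ t, (A i).1 (w i t) (w' i t)) • ξ (relabeledWord τ R w')

/-- The operator `U X U*`. -/
def conjBy {H K : Type} [NormedAddCommGroup H] [InnerProductSpace ℂ H] [NormedAddCommGroup K]
    [InnerProductSpace ℂ K] (U : H ≃ₗᵢ[ℂ] K) (X : H →L[ℂ] H) : K →L[ℂ] K :=
  (U.toContinuousLinearEquiv : H →L[ℂ] K) ∘L X ∘L (U.symm.toContinuousLinearEquiv : K →L[ℂ] H)

/-- After a relabeling, `θ` and `τ` are product unitarily equivalent through unitary matrices
`A₁, …, A_r`, and `X ↦ U X U*` with `U = U_{A₁, …, A_r}` maps `𝔏_θ` onto `𝔏_τ`. -/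
def ProductUnitarilyImplemented {r s : ℕ} {n : Fin r → ℕ} {m : Fin s → ℕ} (θ : PermSet n)
    (τ : PermSet m) [IsLeftCancelMul (Semi θ)] [IsLeftCancelMul (Semi τ)] : Prop :=
  ∃ (R : Relabeling n m) (A : ∀ i, Matrix.unitaryGroup (Fin (n i)) ℂ),
    ImplementsProductEquiv θ (τ.relabel R) A ∧
    ∃ U : Fock (Semi θ) ≃ₗᵢ[ℂ] Fock (Semi τ),
      IsProductUnitary θ τ R A U ∧
      conjBy U '' (wotAlg (Semi θ) : Set (Fock (Semi θ) →L[ℂ] Fock (Semi θ))) =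
        (wotAlg (Semi τ) : Set (Fock (Semi τ) →L[ℂ] Fock (Semi τ)))

end HigherRankToeplitz

end

noncomputable section

namespace HigherRankToeplitz

/-! ### The standard basis of Fock space and pointwise convergence of operators -/

section FockSpace

variable {S : Type}

/-! The substance is that a graded isometric isomorphism, of either pair of algebras, already has
the form in (iii). On generators such a map is a matrix `B`. Its dual action is studied on points,
that is, scalar families satisfying the relations of the semigroup. A point defines a character of
the semigroup, and pairing it with the degree `N` part of the `N`-th power of a combination of
generators, then letting `N` grow, gives `IsPoint.norm_dotProduct_le`: the value at a point is at
most the operator norm times the largest Euclidean norm of a block of the point. Hence `B` maps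
points to points without increasing this maximum norm, and with the inverse matrix at hand it
preserves the norm.

The set of points contains every vector supported in one block and is stable under rescaling each
block separately. A parallelogram law argument (`eq_zero_or_eq_zero_of_norm_map_smul`) then shows
that `B` sends each block into a single block. This produces the bijection of blocks, so a graded
isometric isomorphism is automatically multi-graded, and on each block `B` is unitary. Comparing
degree two coefficients in the relations yields the product unitary equivalence. Conversely, a
product equivalence says exactly that the rotated generators satisfy the relations of `θ`; the
resulting representation applied to the vacuum carries the standard basis to an orthonormal basis,
and the unitary so obtained conjugates both kinds of algebra onto each other.

To use the inverse one must know that it is graded too. For this it suffices that the degree one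
part of every `Φ X` lies in the row space of `B`. In the norm closed case this follows by
approximation, since the row space is finite dimensional. In the WOT closed case `Φ` is not known to
be WOT continuous, so each `T` in `𝔏_θ` is instead written exactly as a scalar plus `∑_e L_e Y_e`
with `Y_e` in `𝔏_θ` (`exists_smul_one_add_mem_genIdeal`), by averaging over gauge unitaries.

Unique factorization is never needed. Its place is taken by `gen_mul_ne_gen_mul`: left cancelation
alone forces the generators of one block to have shifts with orthogonal ranges. -/

theorem inner_ξ (v : S) (x : Fock S) : inner ℂ (ξ v) x = x v := by
  classical
  unfold ξ
  rw [lp.inner_single_left]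
  simp

theorem ξ_apply_self (v : S) : (ξ v : Fock S) v = 1 := by
  rw [← inner_ξ, inner_self_eq_norm_sq_to_K, orthonormal_ξ.1]
  simp

theorem ξ_apply_of_ne {v w : S} (h : v ≠ w) : (ξ v : Fock S) w = 0 := by
  rw [← inner_ξ]
  exact orthonormal_ξ.2 h.symm

theorem dense_span_ξ :
    (Submodule.span ℂ (Set.range (ξ : S → Fock S))).topologicalClosure = ⊤ := by
  rw [Submodule.topologicalClosure_eq_top_iff, Submodule.eq_bot_iff]
  intro x hx
  ext v
  rw [← inner_ξ]
  exact (Submodule.mem_orthogonal _ _).1 hx _ (Submodule.subset_span ⟨v, rfl⟩)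

/-- A closed subspace that contains the standard basis is everything. -/
theorem mem_of_ξ_mem (K : Submodule ℂ (Fock S)) (hK : IsClosed (K : Set (Fock S)))
    (h : ∀ v, ξ v ∈ K) (x : Fock S) : x ∈ K := by
  have h1 : (Submodule.span ℂ (Set.range (ξ : S → Fock S))).topologicalClosure ≤ K :=
    Submodule.topologicalClosure_minimal _
      (Submodule.span_le.2 (by rintro _ ⟨v, rfl⟩; exact h v)) hK
  rw [dense_span_ξ] at h1
  exact h1 trivial

theorem clm_ext {F : Type*} [NormedAddCommGroup F] [NormedSpace ℂ F] {A B : Fock S →L[ℂ] F}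
    (h : ∀ w, A (ξ w) = B (ξ w)) : A = B := by
  ext x
  exact mem_of_ξ_mem (LinearMap.eqLocus A.toLinearMap B.toLinearMap)
    (isClosed_eq A.continuous B.continuous) h x

/-- The isometry that maps the standard basis to an orthonormal family. -/
def ofOrthonormal {H : Type*} [NormedAddCommGroup H] [InnerProductSpace ℂ H] [CompleteSpace H]
    {g : S → H} (hg : Orthonormal ℂ g) : Fock S →ₗᵢ[ℂ] H :=
  hg.orthogonalFamily.linearIsometry

theorem ofOrthonormal_ξ {H : Type*} [NormedAddCommGroup H] [InnerProductSpace ℂ H]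
    [CompleteSpace H] {g : S → H} (hg : Orthonormal ℂ g) (w : S) :
    ofOrthonormal hg (ξ w) = g w := by
  classical
  have h := hg.orthogonalFamily.linearIsometry_apply_single (i := w) (1 : ℂ)
  have e : (ξ w : Fock S) = lp.single 2 w (1 : ℂ) := by unfold ξ; congr!
  rw [ofOrthonormal, e]
  convert h using 1
  simp

/-- A uniformly bounded sequence of operators that converges on the standard basis converges
pointwise. -/
theorem exists_tendsto_of_forall_ξ {F : Type*} [NormedAddCommGroup F] [NormedSpace ℂ F]
    [CompleteSpace F] (A : ℕ → Fock S →L[ℂ] F) {C : ℝ} (hC : ∀ N, ‖A N‖ ≤ C)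
    (h : ∀ w, ∃ y, Filter.Tendsto (fun N => A N (ξ w)) Filter.atTop (nhds y)) (x : Fock S) :
    ∃ y, Filter.Tendsto (fun N => A N x) Filter.atTop (nhds y) := by
  have hC0 : 0 ≤ C := (norm_nonneg _).trans (hC 0)
  let K : Submodule ℂ (Fock S) :=
    { carrier := {x | ∃ y, Filter.Tendsto (fun N => A N x) Filter.atTop (nhds y)}
      add_mem' := fun {x y} ⟨a, ha⟩ ⟨b, hb⟩ => ⟨a + b, by simpa using ha.add hb⟩
      zero_mem' := ⟨0, by simp⟩
      smul_mem' := fun c x ⟨a, ha⟩ => ⟨c • a, by simpa using ha.const_smul c⟩ }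
  refine mem_of_ξ_mem K ?_ h x
  rw [← isSeqClosed_iff_isClosed]
  intro u x hu hx
  refine cauchySeq_tendsto_of_complete ?_
  rw [Metric.cauchySeq_iff]
  intro ε hε
  -- The summand 1 keeps the denominator positive when `C = 0`.
  obtain ⟨k, hk⟩ := ((Metric.tendsto_atTop.1 hx) (ε / (3 * (C + 1))) (by positivity))
  have hk := hk k le_rfl
  rw [dist_eq_norm, lt_div_iff₀ (by positivity)] at hk
  obtain ⟨N, hN⟩ := (Metric.cauchySeq_iff.1 (hu k).choose_spec.cauchySeq) (ε / 3) (by positivity)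
  refine ⟨N, fun m hm l hl => ?_⟩
  have h1 := hN m hm l hl
  have h2 : ∀ m, ‖A m (u k - x)‖ < ε / 3 := fun m => by
    have := ((A m).le_opNorm (u k - x)).trans (mul_le_mul_of_nonneg_right (hC m) (norm_nonneg _))
    nlinarith [norm_nonneg (u k - x)]
  rw [dist_eq_norm] at h1 ⊢
  have e : A m x - A l x = (A m (u k) - A l (u k)) - A m (u k - x) + A l (u k - x) := by
    simp only [map_sub]; abel
  rw [e]
  have h3 := norm_add_le ((A m (u k) - A l (u k)) - A m (u k - x)) (A l (u k - x))
  have h4 := norm_sub_le (A m (u k) - A l (u k)) (A m (u k - x))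
  linarith [h2 m, h2 l]

end FockSpace

/-! ### Left and right regular representations -/

section Shift

variable {S : Type} [Monoid S] [IsLeftCancelMul S]

theorem shift_one : shift (1 : S) = 1 := clm_ext fun w => by simp [shift_ξ]

theorem shift_mul (v w : S) : shift (v * w) = shift v * shift w :=
  clm_ext fun u => by simp [shift_ξ, mul_assoc]

/-- The left regular representation. -/
def shiftHom (S : Type) [Monoid S] [IsLeftCancelMul S] : S →* (Fock S →L[ℂ] Fock S) where
  toFun := shift
  map_one' := shift_one
  map_mul' := shift_mul

theorem shiftHom_apply (v : S) : shiftHom S v = shift v := rfl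

theorem inner_shift_shift_self (v : S) (x y : Fock S) :
    inner ℂ (shift v x) (shift v y) = inner ℂ x y :=
  LinearIsometry.inner_map_map _ x y

theorem shift_apply_mul (v w : S) (x : Fock S) : shift v x (v * w) = x w := by
  have h : (innerSL ℂ (ξ (v * w) : Fock S)) ∘L shift v = innerSL ℂ (ξ w : Fock S) := by
    refine clm_ext fun u => ?_
    simp only [ContinuousLinearMap.comp_apply, innerSL_apply_apply, shift_ξ]
    rw [← shift_ξ, ← shift_ξ, inner_shift_shift_self]
  have := congrArg (fun A => A x) h
  simpa [innerSL_apply_apply, inner_ξ] using this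

theorem shift_apply_of_forall_ne {v u : S} (h : ∀ w, v * w ≠ u) (x : Fock S) :
    shift v x u = 0 := by
  have h : (innerSL ℂ (ξ u : Fock S)) ∘L shift v = 0 := by
    refine clm_ext fun w => ?_
    simp [innerSL_apply_apply, shift_ξ, inner_ξ, ξ_apply_of_ne (h w)]
  have := congrArg (fun A => A x) h
  simpa [innerSL_apply_apply, inner_ξ] using this

/-- Left shifts by elements without common right multiples have orthogonal ranges. -/
theorem inner_shift_shift_of_forall_ne {v v' : S} (h : ∀ w w', v * w ≠ v' * w')
    (x y : Fock S) : inner ℂ (shift v x) (shift v' y) = 0 := by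
  have h1 : ∀ w, (innerSL ℂ (ξ (v * w) : Fock S)) ∘L shift v' = 0 := fun w => by
    refine clm_ext fun w' => ?_
    simp [innerSL_apply_apply, shift_ξ, inner_ξ, ξ_apply_of_ne (h w w').symm]
  have h2 : (innerSL ℂ (shift v' y : Fock S)) ∘L shift v = 0 := by
    refine clm_ext fun w => ?_
    have := congrArg (fun A => A y) (h1 w)
    simp only [ContinuousLinearMap.comp_apply, innerSL_apply_apply,
      zero_apply, shift_ξ] at this ⊢
    rw [← inner_conj_symm, this, map_zero]
  have := congrArg (fun A => A x) h2
  simp only [ContinuousLinearMap.comp_apply, innerSL_apply_apply,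
    zero_apply] at this
  rw [← inner_conj_symm, this, map_zero]

/-- The adjoint of a left shift cancels on the left. -/
theorem adjoint_shift_mul_shift_self (v : S) :
    ContinuousLinearMap.adjoint (shift v : Fock S →L[ℂ] Fock S) * shift v = 1 := by
  ext1 x
  refine ext_inner_left ℂ fun y => ?_
  simp [ContinuousLinearMap.adjoint_inner_right, inner_shift_shift_self]

theorem adjoint_shift_mul_shift_of_forall_ne {v v' : S} (h : ∀ w w', v * w ≠ v' * w') :
    ContinuousLinearMap.adjoint (shift v : Fock S →L[ℂ] Fock S) * shift v' = 0 := by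
  ext1 x
  refine ext_inner_left ℂ fun y => ?_
  simp [ContinuousLinearMap.adjoint_inner_right, inner_shift_shift_of_forall_ne h]

theorem adjoin_range_shift :
    Subalgebra.toSubmodule (Algebra.adjoin ℂ (Set.range (shift : S → Fock S →L[ℂ] Fock S))) =
      Submodule.span ℂ (Set.range (shift : S → Fock S →L[ℂ] Fock S)) := by
  have h : (Set.range (shift : S → Fock S →L[ℂ] Fock S)) =
      (MonoidHom.mrange (shiftHom S) : Set (Fock S →L[ℂ] Fock S)) := by
    ext; simp [shiftHom_apply]
  rw [h, Algebra.adjoin_eq_span, Submonoid.closure_eq]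

/-- The right shift `ξ_v ↦ ξ_{vw}`. -/
def rightShift {S : Type} [Monoid S] [IsRightCancelMul S] (w : S) : Fock S →L[ℂ] Fock S :=
  (ofOrthonormal (g := fun v : S => (ξ (v * w) : Fock S))
    (orthonormal_ξ.comp (fun v => v * w) (mul_left_injective w))).toContinuousLinearMap

theorem rightShift_ξ {S : Type} [Monoid S] [IsRightCancelMul S] (v w : S) :
    rightShift w (ξ v : Fock S) = ξ (v * w) :=
  ofOrthonormal_ξ (g := fun v : S => (ξ (v * w) : Fock S))
    (orthonormal_ξ.comp (fun v => v * w) (mul_left_injective w)) v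

theorem shift_mul_rightShift {S : Type} [Monoid S] [IsCancelMul S] (v w : S) :
    shift v * rightShift w = rightShift w * shift v :=
  clm_ext fun u => by simp [shift_ξ, rightShift_ξ, mul_assoc]

end Shift

/-! ### Closedness in the weak operator topology -/

section WeakOperatorTopology

variable {H K : Type} [NormedAddCommGroup H] [InnerProductSpace ℂ H]
  [NormedAddCommGroup K] [InnerProductSpace ℂ K]

/-- A set of operators is WOT closed if it is closed in the weak operator topology. -/
def IsWOTClosed (B : Set (H →L[ℂ] H)) : Prop := IsClosed {Y : H →WOT[ℂ] H | Y.toCLM ∈ B}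

/-- A map of operators is continuous in the weak operator topologies if it is so after pairing
with vectors and functionals. -/
theorem continuous_wot_of_forall {G : (H →L[ℂ] H) → (K →L[ℂ] K)}
    (h : ∀ (x : K) (f : StrongDual ℂ K), Continuous fun Y : H →WOT[ℂ] H => f (G Y.toCLM x)) :
    Continuous fun Y : H →WOT[ℂ] H => ContinuousLinearMapWOT.ofCLM (G Y.toCLM) :=
  ContinuousLinearMapWOT.continuous_of_dual_apply_continuous h

theorem continuous_wot_pairing (x : H) (f : StrongDual ℂ H) :
    Continuous fun Y : H →WOT[ℂ] H => f (Y.toCLM x) :=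
  ContinuousLinearMapWOT.continuous_dual_apply x f

/-- A map `X ↦ A X B` is WOT continuous. -/
theorem continuous_wot_comp_comp (A : H →L[ℂ] K) (B : K →L[ℂ] H) :
    Continuous fun Y : H →WOT[ℂ] H => ContinuousLinearMapWOT.ofCLM (A ∘L Y.toCLM ∘L B) :=
  continuous_wot_of_forall (G := fun X => A ∘L X ∘L B)
    fun x f => continuous_wot_pairing (B x) (f ∘L A)

theorem IsWOTClosed.preimage {B : Set (K →L[ℂ] K)} (hB : IsWOTClosed B)
    {G : (H →L[ℂ] H) → (K →L[ℂ] K)}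
    (hG : Continuous fun Y : H →WOT[ℂ] H => ContinuousLinearMapWOT.ofCLM (G Y.toCLM)) :
    IsWOTClosed (G ⁻¹' B) :=
  IsClosed.preimage hG hB

theorem IsWOTClosed.mem_of_tendsto {B : Set (H →L[ℂ] H)} (hB : IsWOTClosed B)
    {A : ℕ → H →L[ℂ] H} {T : H →L[ℂ] H} (hA : ∀ N, A N ∈ B)
    (h : ∀ x, Filter.Tendsto (fun N => A N x) Filter.atTop (nhds (T x))) : T ∈ B := by
  have h1 : Filter.Tendsto (fun N => ContinuousLinearMapWOT.ofCLM (A N)) Filter.atTop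
      (nhds (ContinuousLinearMapWOT.ofCLM T : H →WOT[ℂ] H)) :=
    ContinuousLinearMapWOT.tendsto_iff_forall_dual_apply_tendsto.2
      fun x f => (f.continuous.tendsto _).comp (h x)
  exact IsClosed.mem_of_tendsto (s := {Y : H →WOT[ℂ] H | Y.toCLM ∈ B}) hB h1 (Filter.Eventually.of_forall hA)

variable {S : Type} [Monoid S] [IsLeftCancelMul S]

theorem isWOTClosed_wotAlg : IsWOTClosed (wotAlg S : Set (Fock S →L[ℂ] Fock S)) := by
  have : {Y : Fock S →WOT[ℂ] Fock S | Y.toCLM ∈ (wotAlg S : Set (Fock S →L[ℂ] Fock S))} =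
      ⋂ B ∈ {B : Subalgebra ℂ (Fock S →L[ℂ] Fock S) | (∀ v : S, shift v ∈ B) ∧
        IsClosed {Y : Fock S →WOT[ℂ] Fock S | Y.toCLM ∈ B}},
        {Y : Fock S →WOT[ℂ] Fock S | Y.toCLM ∈ B} := by
    ext Y
    simp only [wotAlg, SetLike.mem_coe, Algebra.mem_sInf, Set.mem_ofPred_eq, Set.mem_iInter]
  rw [IsWOTClosed, this]
  exact isClosed_biInter fun B hB => hB.2

theorem wotAlg_le {B : Subalgebra ℂ (Fock S →L[ℂ] Fock S)} (h : ∀ v : S, shift v ∈ B)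
    (hB : IsWOTClosed (B : Set (Fock S →L[ℂ] Fock S))) : wotAlg S ≤ B :=
  sInf_le ⟨h, hB⟩

/-- Every WOT closed subspace that contains the left shifts contains `𝔏_S`. -/
theorem wotAlg_le_submodule {M : Submodule ℂ (Fock S →L[ℂ] Fock S)} (h : ∀ v : S, shift v ∈ M)
    (hM : IsWOTClosed (M : Set (Fock S →L[ℂ] Fock S))) {T : Fock S →L[ℂ] Fock S}
    (hT : T ∈ wotAlg S) : T ∈ M := by
  -- Multiplication is separately WOT continuous, so the WOT closure of the algebra generated by the
  -- shifts is again an algebra and contains `𝔏_S`. That algebra is the linear span of the shifts,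
  -- so linear WOT closed conditions need only be checked on shifts.
  have : SeparatelyContinuousMul (Fock S →WOT[ℂ] Fock S) :=
    { continuous_const_mul := fun {a} => continuous_wot_of_forall (G := fun X => a.toCLM * X)
        fun x f => continuous_wot_pairing x (f ∘L a.toCLM)
      continuous_mul_const := fun {a} => continuous_wot_of_forall (G := fun X => X * a.toCLM)
        fun x f => continuous_wot_pairing (a.toCLM x) f }
  let e : (Fock S →WOT[ℂ] Fock S) ≃ₐ[ℂ] (Fock S →L[ℂ] Fock S) :=
    ContinuousLinearMapWOT.algEquiv ℂ
  let P := Algebra.adjoin ℂ (Set.range (shift : S → Fock S →L[ℂ] Fock S))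
  have : IsSemitopologicalSemiring (Fock S →WOT[ℂ] Fock S) := {}
  let Q := (P.comap (e : (Fock S →WOT[ℂ] Fock S) →ₐ[ℂ] _)).topologicalClosure
  have h1 : wotAlg S ≤ Q.comap (e.symm : (Fock S →L[ℂ] Fock S) →ₐ[ℂ] _) := by
    refine wotAlg_le (fun v => ?_) ?_
    · refine Subalgebra.le_topologicalClosure _ ?_
      exact Algebra.subset_adjoin ⟨v, rfl⟩
    · exact Subalgebra.isClosed_topologicalClosure _
  have h2 : (Q : Set (Fock S →WOT[ℂ] Fock S)) ⊆ {Y | Y.toCLM ∈ M} := by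
    refine closure_minimal (fun Y hY => ?_) hM
    have hY : Y.toCLM ∈ Subalgebra.toSubmodule P := hY
    rw [adjoin_range_shift] at hY
    exact Submodule.span_le.2 (by rintro _ ⟨v, rfl⟩; exact h v) hY
  exact h2 (h1 hT)

end WeakOperatorTopology

/-! ### Multi-degree, divisibility by generators, and cancelation -/

section Semigroup

variable {r : ℕ} {n : Fin r → ℕ} (θ : PermSet n)

theorem gen_mul_gen_of_lt {i j : Fin r} (h : i < j) (k : Fin (n i)) (l : Fin (n j)) :
    gen θ i k * gen θ j l = gen θ j (θ i j h (k, l)).2 * gen θ i (θ i j h (k, l)).1 :=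
  PresentedMonoid.mk_eq_mk_of_rel (Rel.comm i j h k l)

theorem gen_mul_gen {i j : Fin r} (h : i ≠ j) (k : Fin (n i)) (l : Fin (n j)) :
    gen θ i k * gen θ j l =
      gen θ j (θ.perm i j h (k, l)).2 * gen θ i (θ.perm i j h (k, l)).1 := by
  unfold PermSet.perm
  split_ifs with hij
  · exact gen_mul_gen_of_lt θ hij k l
  · have hji : j < i := lt_of_le_of_ne (not_lt.mp hij) h.symm
    have := gen_mul_gen_of_lt θ hji ((θ j i hji).symm (l, k)).1 ((θ j i hji).symm (l, k)).2
    simpa using this.symm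

variable {θ}

@[elab_as_elim]
theorem semi_induction {p : Semi θ → Prop} (x : Semi θ) (one : p 1)
    (gen_mul : ∀ i k x, p x → p (gen θ i k * x)) : p x := by
  have hx : x ∈ Submonoid.closure (Set.range (PresentedMonoid.of (Rel θ))) := by
    rw [PresentedMonoid.closure_range_of]; trivial
  induction hx using Submonoid.closure_induction_left with
  | one => exact one
  | mul_left g hg y _ ih =>
    obtain ⟨⟨i, k⟩, rfl⟩ := hg
    exact gen_mul i k y ih

variable (θ) in
/-- The multi-degree as a monoid homomorphism. -/
def mdegHom : Semi θ →* Multiplicative (Fin r → ℕ) :=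
  PresentedMonoid.lift (fun g => Multiplicative.ofAdd (Pi.single g.1 1)) (by
    rintro _ _ ⟨i, j, h, k, l⟩
    simp [mul_comm])

/-- The multi-degree of an element of the semigroup. -/
def mdeg (x : Semi θ) : Fin r → ℕ := (mdegHom θ x).toAdd

theorem mdeg_one : mdeg (1 : Semi θ) = 0 := by simp [mdeg]

theorem mdeg_mul (x y : Semi θ) : mdeg (x * y) = mdeg x + mdeg y := by simp [mdeg]

theorem mdeg_gen (i : Fin r) (k : Fin (n i)) : mdeg (gen θ i k) = Pi.single i 1 := rfl

/-- The total degree of an element of the semigroup. -/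
def tdeg (x : Semi θ) : ℕ := ∑ i, mdeg x i

theorem tdeg_one : tdeg (1 : Semi θ) = 0 := by simp [tdeg, mdeg_one]

theorem tdeg_mul (x y : Semi θ) : tdeg (x * y) = tdeg x + tdeg y := by
  simp [tdeg, mdeg_mul, Finset.sum_add_distrib]

theorem tdeg_gen (i : Fin r) (k : Fin (n i)) : tdeg (gen θ i k) = 1 := by
  simp [tdeg, mdeg_gen, Finset.sum_pi_single']

/-- An element whose multi-degree is positive at `i` is divisible on the left by a generator
of the `i`-th set. -/
theorem exists_eq_gen_mul {x : Semi θ} {i : Fin r} (h : mdeg x i ≠ 0) :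
    ∃ k y, x = gen θ i k * y := by
  induction x using semi_induction with
  | one => simp [mdeg_one] at h
  | gen_mul j l y ih =>
    by_cases hij : j = i
    · subst hij; exact ⟨l, y, rfl⟩
    · rw [mdeg_mul, mdeg_gen, Pi.add_apply, Pi.single_eq_of_ne (Ne.symm hij), zero_add] at h
      obtain ⟨k, z, rfl⟩ := ih h
      exact ⟨(θ.perm j i hij (l, k)).2, gen θ j (θ.perm j i hij (l, k)).1 * z, by
        rw [← mul_assoc, gen_mul_gen θ hij, mul_assoc]⟩

theorem eq_one_of_tdeg_eq_zero {x : Semi θ} (h : tdeg x = 0) : x = 1 := by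
  induction x using semi_induction with
  | one => rfl
  | gen_mul j l y _ => simp [tdeg_mul, tdeg_gen] at h

theorem exists_eq_gen_mul_of_tdeg_ne_zero {x : Semi θ} (h : tdeg x ≠ 0) :
    ∃ i k y, x = gen θ i k * y := by
  induction x using semi_induction with
  | one => simp [tdeg_one] at h
  | gen_mul j l y _ => exact ⟨j, l, y, rfl⟩

theorem finite_tdeg_eq (N : ℕ) : {x : Semi θ | tdeg x = N}.Finite := by
  induction N with
  | zero => exact (Set.finite_singleton 1).subset fun x hx => eq_one_of_tdeg_eq_zero hx
  | succ N ih =>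
    refine (Set.finite_iUnion fun g : Gen n => ih.image fun x => gen θ g.1 g.2 * x).subset ?_
    intro x hx
    have hx : tdeg x = N + 1 := hx
    obtain ⟨i, k, y, rfl⟩ := exists_eq_gen_mul_of_tdeg_ne_zero (x := x) (by omega)
    rw [tdeg_mul, tdeg_gen] at hx
    exact Set.mem_iUnion.2 ⟨⟨i, k⟩, y, by change tdeg y = N; omega, rfl⟩

theorem finite_mdeg_eq (p : Fin r → ℕ) : {x : Semi θ | mdeg x = p}.Finite :=
  (finite_tdeg_eq (∑ i, p i)).subset fun x hx => by
    have hx : mdeg x = p := hx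
    simp [tdeg, hx]

/-- The word of letters `f 0, f 1, …` in the `i`-th generators. -/
def blockWord (θ : PermSet n) (i : Fin r) {p : ℕ} (f : Fin p → Fin (n i)) : Semi θ :=
  (List.ofFn fun t => gen θ i (f t)).prod

theorem mdeg_blockWord (i : Fin r) {p : ℕ} (f : Fin p → Fin (n i)) :
    mdeg (blockWord θ i f) = p • Pi.single i 1 := by
  induction p with
  | zero => simp [blockWord, mdeg_one]
  | succ p ih =>
    have := ih fun t => f t.succ
    rw [blockWord] at this
    rw [blockWord, List.ofFn_succ, List.prod_cons, mdeg_mul, mdeg_gen, this, add_comm,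
      succ_nsmul]

/-- Sending the generators of all other blocks to an adjoined zero respects the relations, because
both sides of a relation contain a letter outside block `i`. What survives is the free monoid on
block `i`, where words are visibly distinct. -/
theorem blockWord_injective (i : Fin r) (p : ℕ) :
    Function.Injective (blockWord θ i : (Fin p → Fin (n i)) → Semi θ) := by
  classical
  let F : Semi θ →* WithZero (FreeMonoid (Fin (n i))) :=
    PresentedMonoid.lift
      (fun g => if h : g.1 = i then ((FreeMonoid.of (h ▸ g.2) : FreeMonoid (Fin (n i))) :
        WithZero (FreeMonoid (Fin (n i)))) else 0) (by
      rintro _ _ ⟨j, j', h, k, l⟩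
      by_cases hj : j = i
      · have hj' : j' ≠ i := fun e => h.ne (hj.trans e.symm)
        simp [hj']
      · simp [hj])
  have hF : ∀ (q : ℕ) (f : Fin q → Fin (n i)), F (blockWord θ i f) =
      ((FreeMonoid.ofList (List.ofFn f) : FreeMonoid (Fin (n i))) :
        WithZero (FreeMonoid (Fin (n i)))) := by
    intro q
    induction q with
    | zero => intro f; simp [blockWord]
    | succ q ih =>
      intro f
      have h1 := ih fun t => f t.succ
      rw [blockWord] at h1
      rw [blockWord, List.ofFn_succ, List.prod_cons, map_mul, h1, List.ofFn_succ,
        FreeMonoid.ofList_cons, WithZero.coe_mul]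
      congr 1
      have : F (gen θ i (f 0)) = if h : i = i then
        ((FreeMonoid.of (h ▸ f 0) : FreeMonoid (Fin (n i))) :
        WithZero (FreeMonoid (Fin (n i)))) else 0 := rfl
      simpa using this
  intro f g h
  have h1 := congrArg F h
  rw [hF, hF, WithZero.coe_inj] at h1
  exact List.ofFn_injective (FreeMonoid.ofList.injective h1)

/-- In a left cancelative `𝔽_θ⁺` distinct generators of the same set have no common right
multiple. -/
theorem gen_mul_ne_gen_mul [IsLeftCancelMul (Semi θ)] {i : Fin r} {k k' : Fin (n i)} (h : k ≠ k')
    (x y : Semi θ) : gen θ i k * x ≠ gen θ i k' * y := by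
  classical
  intro hxy
  set δ : Fin r → ℕ := Pi.single i 1 with hδ
  have hdeg : mdeg x = mdeg y := by
    have := congrArg mdeg hxy
    rw [mdeg_mul, mdeg_mul, mdeg_gen, mdeg_gen] at this
    exact add_left_cancel this
  -- A counting argument. Multiplication maps `Fin (n i) × Z j` onto `Z (j + 1)`, and the collision
  -- `e_k x = e_k' y` persists after right multiplication by each of the `n_i ^ j` words of length
  -- `j` in block `i`. The pairs `(k, x w)` are distinct by left cancelation and can all be dropped
  -- in favour of `(k', y w)`.
  let Z : ℕ → Finset (Semi θ) := fun j => (finite_mdeg_eq (mdeg x + j • δ)).toFinset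
  have hZ : ∀ j z, z ∈ Z j ↔ mdeg z = mdeg x + j • δ := fun j z => by simp [Z]
  have step : ∀ j, (Z (j + 1)).card + n i ^ j ≤ n i * (Z j).card := by
    intro j
    let W : Finset (Fin (n i) × Semi θ) :=
      Finset.univ.image fun f : Fin j → Fin (n i) => (k, x * blockWord θ i f)
    have hW : W.card = n i ^ j := by
      rw [Finset.card_image_of_injective]
      · simp
      · intro f g hfg
        simp only [Prod.mk.injEq, true_and, mul_right_inj] at hfg
        exact blockWord_injective i j hfg
    have hWsub : W ⊆ Finset.univ ×ˢ Z j := by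
      intro a ha
      obtain ⟨f, -, rfl⟩ := Finset.mem_image.1 ha
      simp [hZ, mdeg_mul, mdeg_blockWord, hδ]
    have hcov : Z (j + 1) ⊆ ((Finset.univ ×ˢ Z j) \ W).image fun a => gen θ i a.1 * a.2 := by
      intro z hz
      rw [hZ] at hz
      obtain ⟨a, w, rfl⟩ := exists_eq_gen_mul (x := z) (i := i) (by simp [hz, hδ])
      have hw : mdeg w = mdeg x + j • δ := by
        rw [mdeg_mul, mdeg_gen, succ_nsmul, ← add_assoc, add_comm] at hz
        exact add_right_cancel hz
      by_cases haW : (a, w) ∈ W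
      · obtain ⟨f, -, hf⟩ := Finset.mem_image.1 haW
        simp only [Prod.mk.injEq] at hf
        obtain ⟨rfl, rfl⟩ := hf
        refine Finset.mem_image.2 ⟨(k', y * blockWord θ i f), ?_, ?_⟩
        · rw [Finset.mem_sdiff]
          refine ⟨?_, fun hc => ?_⟩
          · simp [hZ, mdeg_mul, mdeg_blockWord, hδ, hdeg]
          · obtain ⟨g, -, hg⟩ := Finset.mem_image.1 hc
            exact h (Prod.mk.inj hg).1
        · simp only [← mul_assoc, hxy]
      · exact Finset.mem_image.2 ⟨(a, w), by simp [haW, hZ, hw], rfl⟩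
    have h1 := (Finset.card_le_card hcov).trans Finset.card_image_le
    rw [Finset.card_sdiff_of_subset hWsub, hW] at h1
    have h2 := Finset.card_le_card hWsub
    rw [hW] at h2
    rw [Finset.card_product, Finset.card_univ, Fintype.card_fin] at h1 h2
    omega
  have hn : 0 < n i := k.pos
  -- After division by `n_i ^ j` the cardinality of `Z j` drops by at least `1 / n_i` at each step,
  -- which cannot go on for `n_i |Z 0| + 1` steps.
  have key : ∀ j, n i * (Z j).card + j * n i ^ j ≤ n i ^ j * (n i * (Z 0).card) := by
    intro j
    induction j with
    | zero => simp
    | succ j ih =>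
      have h1 := Nat.mul_le_mul_left (n i) (step j)
      have h2 := Nat.mul_le_mul_left (n i) ih
      calc n i * (Z (j + 1)).card + (j + 1) * n i ^ (j + 1)
          = n i * ((Z (j + 1)).card + n i ^ j) + n i * (j * n i ^ j) := by ring
        _ ≤ n i * (n i * (Z j).card) + n i * (j * n i ^ j) := by gcongr
        _ = n i * (n i * (Z j).card + j * n i ^ j) := by ring
        _ ≤ n i * (n i ^ j * (n i * (Z 0).card)) := h2
        _ = n i ^ (j + 1) * (n i * (Z 0).card) := by ring
  have h1 := key (n i * (Z 0).card + 1)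
  have h2 : 0 < n i ^ (n i * (Z 0).card + 1) := by positivity
  nlinarith

theorem gen_mul_eq_gen_mul_iff [IsLeftCancelMul (Semi θ)] {i : Fin r} {k k' : Fin (n i)}
    {x y : Semi θ} : gen θ i k * x = gen θ i k' * y ↔ k = k' ∧ x = y := by
  constructor
  · intro h
    by_cases hk : k = k'
    · subst hk; exact ⟨rfl, mul_left_cancel h⟩
    · exact absurd h (gen_mul_ne_gen_mul hk x y)
  · rintro ⟨rfl, rfl⟩; rfl

theorem gen_inj [IsLeftCancelMul (Semi θ)] {i j : Fin r} {k : Fin (n i)} {l : Fin (n j)} :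
    gen θ i k = gen θ j l ↔ (⟨i, k⟩ : Gen n) = ⟨j, l⟩ := by
  constructor
  · intro h
    have hij : i = j := by
      by_contra hij
      have := congrFun (congrArg mdeg h) i
      simp [mdeg_gen, hij] at this
    subst hij
    have : gen θ i k * 1 = gen θ i l * 1 := by rw [h]
    rw [(gen_mul_eq_gen_mul_iff.1 this).1]
  · intro h
    cases h
    rfl

end Semigroup

/-! ### Factorization of elements into words ordered by blocks -/

section Words

variable {r : ℕ} {n : Fin r → ℕ} {θ : PermSet n}

/-- The submonoid of words in the `i`-th generators. -/
def blockMonoid (θ : PermSet n) (i : Fin r) : Submonoid (Semi θ) :=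
  Submonoid.closure (Set.range (gen θ i))

theorem exists_blockWord_eq {i : Fin r} {u : Semi θ} (hu : u ∈ blockMonoid θ i) :
    ∃ (p : ℕ) (f : Fin p → Fin (n i)), blockWord θ i f = u := by
  induction hu using Submonoid.closure_induction_left with
  | one => exact ⟨0, Fin.elim0, by simp [blockWord]⟩
  | mul_left g hg y _ ih =>
    obtain ⟨k, rfl⟩ := hg
    obtain ⟨p, f, rfl⟩ := ih
    exact ⟨p + 1, Fin.cons k f, by simp [blockWord, List.ofFn_succ]⟩

theorem exists_gen_mul_eq_mul_gen {i j : Fin r} (h : i ≠ j) {u : Semi θ}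
    (hu : u ∈ blockMonoid θ j) (k : Fin (n i)) :
    ∃ u' ∈ blockMonoid θ j, ∃ k', gen θ i k * u = u' * gen θ i k' := by
  induction hu using Submonoid.closure_induction_left generalizing k with
  | one => exact ⟨1, one_mem _, k, by simp⟩
  | mul_left g hg y _ ih =>
    obtain ⟨l, rfl⟩ := hg
    obtain ⟨u', hu', k', hk'⟩ := ih (θ.perm i j h (k, l)).1
    refine ⟨gen θ j (θ.perm i j h (k, l)).2 * u',
      mul_mem (Submonoid.subset_closure ⟨_, rfl⟩) hu', k', ?_⟩
    rw [← mul_assoc, gen_mul_gen θ h, mul_assoc, hk', mul_assoc]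

/-- The new letter is pushed to the right through the blocks ahead of its own. The relations change
letters on the way but keep every block word inside its block, until the letter joins block `i`. -/
theorem exists_gen_mul_prod_map (l : List (Fin r)) (hl : l.Nodup) {i : Fin r} (hi : i ∈ l)
    (k : Fin (n i)) (u : Fin r → Semi θ) (hu : ∀ j, u j ∈ blockMonoid θ j) :
    ∃ u' : Fin r → Semi θ, (∀ j, u' j ∈ blockMonoid θ j) ∧
      gen θ i k * (l.map u).prod = (l.map u').prod := by
  have hupd : ∀ (j : Fin r) (v : Fin r → Semi θ) (x : Semi θ) (l : List (Fin r)), j ∉ l →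
      (l.map (Function.update v j x)) = l.map v := fun j v x l hj =>
    List.map_congr_left fun a ha =>
      Function.update_of_ne (fun e : a = j => hj (by rwa [← e])) _ _
  have hmem : ∀ (j : Fin r) (v : Fin r → Semi θ) (x : Semi θ), (∀ a, v a ∈ blockMonoid θ a) →
      x ∈ blockMonoid θ j → ∀ a, Function.update v j x a ∈ blockMonoid θ a := by
    intro j v x hv hx a
    by_cases ha : a = j
    · subst ha; simpa using hx
    · simpa [ha] using hv a
  induction l generalizing k u with
  | nil => simp at hi
  | cons j l ih =>
    rw [List.nodup_cons] at hl
    by_cases hij : i = j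
    · subst hij
      refine ⟨Function.update u i (gen θ i k * u i),
        hmem _ _ _ hu (mul_mem (Submonoid.subset_closure ⟨k, rfl⟩) (hu i)), ?_⟩
      rw [List.map_cons, List.map_cons, hupd i u _ l hl.1]
      simp [mul_assoc]
    · obtain ⟨v, hv, k', hk'⟩ := exists_gen_mul_eq_mul_gen hij (hu j) k
      obtain ⟨u', hu', h'⟩ := ih hl.2 (by simpa [hij] using hi) k' u hu
      refine ⟨Function.update u' j v, hmem _ _ _ hu' hv, ?_⟩
      rw [List.map_cons, List.map_cons, hupd j u' _ l hl.1]
      simp only [List.prod_cons, Function.update_self]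
      rw [← mul_assoc, hk', mul_assoc, h']

/-- Every element of the semigroup is a word `w₁ w₂ ⋯ w_r`. -/
theorem exists_word_eq (x : Semi θ) :
    ∃ (p : Fin r → ℕ) (w : ∀ i, Fin (p i) → Fin (n i)), word θ w = x := by
  have h : ∃ u : Fin r → Semi θ, (∀ j, u j ∈ blockMonoid θ j) ∧
      x = ((List.finRange r).map u).prod := by
    induction x using semi_induction with
    | one => exact ⟨fun _ => 1, fun _ => one_mem _, by simp⟩
    | gen_mul i k x ih =>
      obtain ⟨u, hu, rfl⟩ := ih
      obtain ⟨u', hu', h'⟩ := exists_gen_mul_prod_map _ (List.nodup_finRange r)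
        (List.mem_finRange i) k u hu
      exact ⟨u', hu', h'⟩
  obtain ⟨u, hu, rfl⟩ := h
  choose p f hf using fun i => exists_blockWord_eq (hu i)
  refine ⟨p, f, ?_⟩
  rw [word, ← List.ofFn_eq_map]
  congr 1
  congr 1
  funext i
  exact hf i

end Words

section Relabel

variable {r s : ℕ} {n : Fin r → ℕ} {m : Fin s → ℕ}

theorem gen_mul_gen_relabel (τ : PermSet m) (R : Relabeling n m) {i j : Fin r} (h : i < j)
    (k : Fin (n i)) (l : Fin (n j)) :
    gen τ (R.σ i) (R.ι i k) * gen τ (R.σ j) (R.ι j l) =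
      gen τ (R.σ j) (R.ι j (τ.relabel R i j h (k, l)).2) *
        gen τ (R.σ i) (R.ι i (τ.relabel R i j h (k, l)).1) := by
  rw [gen_mul_gen τ (R.σ.injective.ne h.ne)]
  simp [PermSet.relabel, Equiv.permCongr_apply]

end Relabel

/-- Expansion of an ordered product of linear combinations. -/
theorem prod_ofFn_sum_smul {R : Type*} [Semiring R] [Algebra ℂ R] {p : ℕ} {ι : Fin p → Type}
    [∀ t, Fintype (ι t)] (a : ∀ t, ι t → ℂ) (x : ∀ t, ι t → R) :
    (List.ofFn fun t => ∑ l, a t l • x t l).prod =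
      ∑ f : ∀ t, ι t, (∏ t, a t (f t)) • (List.ofFn fun t => x t (f t)).prod := by
  induction p with
  | zero => simp
  | succ p ih =>
    rw [List.ofFn_succ, List.prod_cons, ih (fun t => a t.succ) fun t => x t.succ,
      ← (Fin.consEquiv ι).sum_comp, Fintype.sum_prod_type, Finset.sum_mul]
    refine Finset.sum_congr rfl fun l _ => ?_
    rw [Finset.mul_sum]
    refine Finset.sum_congr rfl fun f _ => ?_
    rw [Fin.prod_univ_succ, List.ofFn_succ, List.prod_cons, smul_mul_smul_comm]
    simp [Fin.consEquiv]

/-! ### Product unitary equivalence in terms of the relations -/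

section ProductEquivalence

variable {r : ℕ} {n : Fin r → ℕ} {θ τ : PermSet n} {A : ∀ i, Matrix.unitaryGroup (Fin (n i)) ℂ}

/-- Entrywise form of the product unitary equivalence. -/
theorem implementsProductEquiv_iff :
    ImplementsProductEquiv θ τ A ↔ ∀ (i j : Fin r) (h : i < j) (x y : Fin (n i) × Fin (n j)),
      (A i).1 x.1 y.1 * (A j).1 x.2 y.2 =
        (A i).1 (θ i j h x).1 (τ i j h y).1 * (A j).1 (θ i j h x).2 (τ i j h y).2 := by
  refine forall_congr' fun i => forall_congr' fun j => forall_congr' fun h => ?_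
  set M : Matrix (Fin (n i) × Fin (n j)) (Fin (n i) × Fin (n j)) ℂ := (A i).1 ⊗ₖ (A j).1 with hM
  have hi : (A i).1 * (A i).1ᴴ = 1 := Matrix.mem_unitaryGroup_iff.1 (A i).2
  have hj : (A j).1 * (A j).1ᴴ = 1 := Matrix.mem_unitaryGroup_iff.1 (A j).2
  have h1 : M * Mᴴ = 1 := by
    rw [hM, Matrix.conjTranspose_kronecker, ← Matrix.mul_kronecker_mul, hi, hj,
      Matrix.one_kronecker_one]
  have h2 : Mᴴ * M = 1 := mul_eq_one_comm.1 h1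
  have h3 : permUnitary (θ i j h) = M * permUnitary (τ i j h) * Mᴴ ↔
      permUnitary (θ i j h) * M = M * permUnitary (τ i j h) := by
    constructor
    · intro e; rw [e, Matrix.mul_assoc, h2, Matrix.mul_one]
    · intro e; rw [← e, Matrix.mul_assoc, h1, Matrix.mul_one]
  rw [h3]
  have h4 : ∀ x y, (permUnitary (θ i j h) * M) (θ i j h x) y = M x y := fun x y => by
    simp [Matrix.mul_apply, permUnitary]
  have h5 : ∀ x y, (M * permUnitary (τ i j h)) x y = M x (τ i j h y) := fun x y => by
    simp [Matrix.mul_apply, permUnitary]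
  constructor
  · intro e x y
    have := congrFun (congrFun e (θ i j h x)) y
    rwa [h4, h5] at this
  · intro e
    ext x y
    obtain ⟨x, rfl⟩ := (θ i j h).surjective x
    rw [h4, h5]
    exact e x y

/-- Elements that satisfy the relations of `τ` are mapped by `A` to elements that satisfy the
relations of `θ`. -/
theorem ImplementsProductEquiv.sum_mul_sum (hA : ImplementsProductEquiv θ τ A) {R : Type*}
    [Semiring R] [Algebra ℂ R] {X : ∀ i, Fin (n i) → R}
    (hX : ∀ (i j : Fin r) (h : i < j) (k : Fin (n i)) (l : Fin (n j)),
      X i k * X j l = X j (τ i j h (k, l)).2 * X i (τ i j h (k, l)).1)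
    {i j : Fin r} (h : i < j) (k : Fin (n i)) (l : Fin (n j)) :
    (∑ x, (A i).1 k x • X i x) * (∑ y, (A j).1 l y • X j y) =
      (∑ y, (A j).1 (θ i j h (k, l)).2 y • X j y) *
        (∑ x, (A i).1 (θ i j h (k, l)).1 x • X i x) := by
  rw [implementsProductEquiv_iff] at hA
  rw [Finset.sum_mul_sum, Finset.sum_mul_sum, Finset.sum_comm (s := Finset.univ (α := Fin (n j))),
    ← Fintype.sum_prod_type', ← Fintype.sum_prod_type']
  refine Fintype.sum_equiv (τ i j h) _ _ fun y => ?_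
  rw [smul_mul_smul_comm, smul_mul_smul_comm, hX i j h, hA i j h (k, l) y]
  congr 1
  ring

end ProductEquivalence

/-! ### Conjugation of the operator algebras by a unitary -/

section Conjugation

variable {S T : Type}

theorem conjStarAlgEquiv_eq_of_comp_eq {H K : Type} [NormedAddCommGroup H] [InnerProductSpace ℂ H]
    [CompleteSpace H] [NormedAddCommGroup K] [InnerProductSpace ℂ K] [CompleteSpace K]
    (U : H ≃ₗᵢ[ℂ] K) {X : H →L[ℂ] H} {Y : K →L[ℂ] K} (h : ∀ x, U (X x) = Y (U x)) :
    U.conjStarAlgEquiv X = Y := by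
  ext y
  simp [h]

/-- A unitary operator as an equivalence of operator algebras. -/
def conjAlgEquiv (U : Fock S ≃ₗᵢ[ℂ] Fock T) :
    (Fock S →L[ℂ] Fock S) ≃ₐ[ℂ] (Fock T →L[ℂ] Fock T) :=
  (U.conjStarAlgEquiv : (Fock S →L[ℂ] Fock S) ≃⋆ₐ[ℂ] (Fock T →L[ℂ] Fock T)).toAlgEquiv

theorem conjAlgEquiv_symm (U : Fock S ≃ₗᵢ[ℂ] Fock T) :
    (conjAlgEquiv U).symm = conjAlgEquiv U.symm := rfl

theorem isometry_conjAlgEquiv (U : Fock S ≃ₗᵢ[ℂ] Fock T) : Isometry (conjAlgEquiv U) :=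
  StarAlgEquiv.isometry
    (U.conjStarAlgEquiv : (Fock S →L[ℂ] Fock S) ≃⋆ₐ[ℂ] (Fock T →L[ℂ] Fock T))

theorem map_conjAlgEquiv_eq {U : Fock S ≃ₗᵢ[ℂ] Fock T} {B : Subalgebra ℂ (Fock S →L[ℂ] Fock S)}
    {C : Subalgebra ℂ (Fock T →L[ℂ] Fock T)} (h1 : B ≤ C.comap (conjAlgEquiv U).toAlgHom)
    (h2 : C ≤ B.comap (conjAlgEquiv U.symm).toAlgHom) :
    B.map (conjAlgEquiv U).toAlgHom = C := by
  refine le_antisymm (Subalgebra.map_le.2 h1) fun Y hY => ?_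
  exact ⟨conjAlgEquiv U.symm Y, h2 hY, (conjAlgEquiv U).apply_symm_apply Y⟩

variable [Monoid S] [IsLeftCancelMul S] [Monoid T] [IsLeftCancelMul T]

/-- The operator algebra generated by the left shifts. -/
def polyAlg (S : Type) [Monoid S] [IsLeftCancelMul S] : Subalgebra ℂ (Fock S →L[ℂ] Fock S) :=
  Algebra.adjoin ℂ (Set.range (shift : S → Fock S →L[ℂ] Fock S))

theorem shift_mem_polyAlg (v : S) : shift v ∈ polyAlg S := Algebra.subset_adjoin ⟨v, rfl⟩

theorem polyAlg_le_normAlg : polyAlg S ≤ normAlg S := Subalgebra.le_topologicalClosure _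

theorem polyAlg_le {B : Subalgebra ℂ (Fock S →L[ℂ] Fock S)} (h : ∀ v : S, shift v ∈ B) :
    polyAlg S ≤ B :=
  Algebra.adjoin_le (by rintro _ ⟨v, rfl⟩; exact h v)

theorem polyAlg_le_wotAlg : polyAlg S ≤ wotAlg S := polyAlg_le shift_mem_wotAlg

theorem normAlg_le_comap_conjAlgEquiv {U : Fock S ≃ₗᵢ[ℂ] Fock T}
    (h : ∀ v : S, conjAlgEquiv U (shift v) ∈ polyAlg T) :
    normAlg S ≤ (normAlg T).comap (conjAlgEquiv U).toAlgHom :=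
  Subalgebra.topologicalClosure_minimal (polyAlg_le (B := (normAlg T).comap (conjAlgEquiv U).toAlgHom) fun v =>
      polyAlg_le_normAlg (h v))
    ((Subalgebra.isClosed_topologicalClosure _).preimage (isometry_conjAlgEquiv U).continuous)

theorem wotAlg_le_comap_conjAlgEquiv {U : Fock S ≃ₗᵢ[ℂ] Fock T}
    (h : ∀ v : S, conjAlgEquiv U (shift v) ∈ polyAlg T) :
    wotAlg S ≤ (wotAlg T).comap (conjAlgEquiv U).toAlgHom :=
  wotAlg_le (fun v => polyAlg_le_wotAlg (h v))
    (isWOTClosed_wotAlg.preimage (G := fun X => conjAlgEquiv U X)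
      (continuous_wot_comp_comp (U.toContinuousLinearEquiv : Fock S →L[ℂ] Fock T)
        (U.symm.toContinuousLinearEquiv : Fock T →L[ℂ] Fock S)))

end Conjugation

/-! ### From a product unitary equivalence to multi-graded isomorphisms -/

section Implemented

variable {r s : ℕ} {n : Fin r → ℕ} {m : Fin s → ℕ} {θ : PermSet n} {τ : PermSet m}
  [IsLeftCancelMul (Semi τ)]

/-- The operator `∑_l (A_i)_{kl} L_{e_{σ i, ι_i l}}`. -/
def rotatedShift (τ : PermSet m) [IsLeftCancelMul (Semi τ)] (R : Relabeling n m)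
    (A : ∀ i, Matrix.unitaryGroup (Fin (n i)) ℂ) (i : Fin r) (k : Fin (n i)) :
    Fock (Semi τ) →L[ℂ] Fock (Semi τ) :=
  ∑ l, (A i).1 k l • shift (gen τ (R.σ i) (R.ι i l))

theorem shift_gen_relabel_mul (τ : PermSet m) [IsLeftCancelMul (Semi τ)] (R : Relabeling n m)
    (i j : Fin r) (h : i < j) (k : Fin (n i)) (l : Fin (n j)) :
    shift (gen τ (R.σ i) (R.ι i k)) * shift (gen τ (R.σ j) (R.ι j l)) =
      shift (gen τ (R.σ j) (R.ι j (τ.relabel R i j h (k, l)).2)) *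
        shift (gen τ (R.σ i) (R.ι i (τ.relabel R i j h (k, l)).1)) := by
  rw [← shift_mul, ← shift_mul, gen_mul_gen_relabel]

/-- The representation of `𝔽_θ⁺` by products of the operators `∑_l (A_i)_{kl} L_{e_{σ i, ι_i l}}`. -/
def rotatedHom {R : Relabeling n m} {A : ∀ i, Matrix.unitaryGroup (Fin (n i)) ℂ}
    (hA : ImplementsProductEquiv θ (τ.relabel R) A) :
    Semi θ →* (Fock (Semi τ) →L[ℂ] Fock (Semi τ)) :=
  PresentedMonoid.lift (fun g => rotatedShift τ R A g.1 g.2) (by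
    rintro _ _ ⟨i, j, h, k, l⟩
    simpa [rotatedShift] using hA.sum_mul_sum (shift_gen_relabel_mul τ R) h k l)

variable {R : Relabeling n m} {A : ∀ i, Matrix.unitaryGroup (Fin (n i)) ℂ}

theorem rotatedHom_gen (hA : ImplementsProductEquiv θ (τ.relabel R) A) (i : Fin r)
    (k : Fin (n i)) : rotatedHom hA (gen θ i k) = rotatedShift τ R A i k := rfl

theorem rotatedHom_word (hA : ImplementsProductEquiv θ (τ.relabel R) A) {p : Fin r → ℕ}
    (w : ∀ i, Fin (p i) → Fin (n i)) :
    rotatedHom hA (word θ w) = ∑ w' : (∀ i, Fin (p i) → Fin (n i)),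
      (∏ i, ∏ t, (A i).1 (w i t) (w' i t)) • shift (relabeledWord τ R w') := by
  have h1 : ∀ {q : ℕ} (f : Fin q → Semi τ),
      shift (List.ofFn f).prod = (List.ofFn fun t => shift (f t)).prod := fun f => by
    rw [← shiftHom_apply, map_list_prod, List.map_ofFn]
    rfl
  rw [word, map_list_prod, List.map_ofFn]
  simp only [relabeledWord, h1]
  rw [← prod_ofFn_sum_smul (ι := fun i => Fin (p i) → Fin (n i))
    (fun i f => ∏ t, (A i).1 (w i t) (f t))
    fun i f => (List.ofFn fun t => shift (gen τ (R.σ i) (R.ι i (f t)))).prod]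
  congr 2
  funext i
  rw [Function.comp_apply, map_list_prod, List.map_ofFn]
  rw [← prod_ofFn_sum_smul (ι := fun _ => Fin (n i))
    (fun t l => (A i).1 (w i t) l) fun t l => shift (gen τ (R.σ i) (R.ι i l))]
  rfl

/-- Ordered words exhaust the semigroup, and expanding the representation on a word reproduces the
defining sum. Since `rotatedHom hA` is a homomorphism on the semigroup, the prescription does not
depend on the word chosen for an element. -/
theorem isProductUnitary_iff (hA : ImplementsProductEquiv θ (τ.relabel R) A)
    {U : Fock (Semi θ) ≃ₗᵢ[ℂ] Fock (Semi τ)} :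
    IsProductUnitary θ τ R A U ↔ ∀ x, U (ξ x) = rotatedHom hA x (ξ 1) := by
  have h : ∀ (p : Fin r → ℕ) (w : ∀ i, Fin (p i) → Fin (n i)),
      rotatedHom hA (word θ w) (ξ 1) = ∑ w' : (∀ i, Fin (p i) → Fin (n i)),
        (∏ i, ∏ t, (A i).1 (w i t) (w' i t)) • ξ (relabeledWord τ R w') := fun p w => by
    simp [rotatedHom_word, shift_ξ]
  constructor
  · intro hU x
    obtain ⟨p, w, rfl⟩ := exists_word_eq x
    rw [hU, h]
  · intro hU p w
    rw [hU, h]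

theorem sum_star_smul_rotatedShift (τ : PermSet m) [IsLeftCancelMul (Semi τ)] (R : Relabeling n m)
    (A : ∀ i, Matrix.unitaryGroup (Fin (n i)) ℂ) (i : Fin r) (l : Fin (n i)) :
    ∑ k, star ((A i).1 k l) • rotatedShift τ R A i k = shift (gen τ (R.σ i) (R.ι i l)) := by
  have h : (A i).1ᴴ * (A i).1 = 1 := Matrix.mem_unitaryGroup_iff'.1 (A i).2
  simp only [rotatedShift, Finset.smul_sum, smul_smul]
  rw [Finset.sum_comm]
  simp only [← Finset.sum_smul]
  have h' : ∀ l', ∑ k, star ((A i).1 k l) * (A i).1 k l' = (1 : Matrix _ _ ℂ) l l' := fun l' => by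
    rw [← h, Matrix.mul_apply]; simp
  simp only [h', Matrix.one_apply]
  simp

theorem rotatedHom_mem_polyAlg (hA : ImplementsProductEquiv θ (τ.relabel R) A) (x : Semi θ) :
    rotatedHom hA x ∈ polyAlg (Semi τ) := by
  induction x using semi_induction with
  | one => rw [map_one]; exact one_mem _
  | gen_mul i k x ih =>
    rw [map_mul, rotatedHom_gen]
    exact mul_mem (sum_mem fun l _ => Subalgebra.smul_mem _ (shift_mem_polyAlg _) _) ih

variable [IsLeftCancelMul (Semi θ)]

theorem conjAlgEquiv_shift (hA : ImplementsProductEquiv θ (τ.relabel R) A)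
    {U : Fock (Semi θ) ≃ₗᵢ[ℂ] Fock (Semi τ)} (hU : ∀ x, U (ξ x) = rotatedHom hA x (ξ 1))
    (x : Semi θ) : conjAlgEquiv U (shift x) = rotatedHom hA x := by
  refine conjStarAlgEquiv_eq_of_comp_eq U fun y => ?_
  have : (U.toContinuousLinearEquiv : Fock (Semi θ) →L[ℂ] Fock (Semi τ)) ∘L shift x =
      rotatedHom hA x ∘L (U.toContinuousLinearEquiv : Fock (Semi θ) →L[ℂ] Fock (Semi τ)) :=
    clm_ext fun w => by simp [shift_ξ, hU]
  exact congrArg (fun B => B y) this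

/-- Unitarity of the `A_i` writes every generating shift as a combination of rotated shifts, and
these are conjugates of generating shifts of `θ`. -/
theorem conjAlgEquiv_symm_shift_mem_polyAlg (hA : ImplementsProductEquiv θ (τ.relabel R) A)
    {U : Fock (Semi θ) ≃ₗᵢ[ℂ] Fock (Semi τ)} (hU : ∀ x, U (ξ x) = rotatedHom hA x (ξ 1))
    (y : Semi τ) : conjAlgEquiv U.symm (shift y) ∈ polyAlg (Semi θ) := by
  induction y using semi_induction with
  | one => rw [shift_one, map_one]; exact one_mem _
  | gen_mul j l y ih =>
    rw [shift_mul, map_mul]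
    refine mul_mem ?_ ih
    obtain ⟨i, rfl⟩ := R.σ.surjective j
    obtain ⟨l, rfl⟩ := (R.ι i).surjective l
    rw [← sum_star_smul_rotatedShift, map_sum]
    refine sum_mem fun k _ => ?_
    rw [map_smul, ← rotatedHom_gen hA, ← conjAlgEquiv_shift hA hU, ← conjAlgEquiv_symm,
      AlgEquiv.symm_apply_apply]
    exact Subalgebra.smul_mem _ (shift_mem_polyAlg _) _

theorem map_normAlg_eq (hA : ImplementsProductEquiv θ (τ.relabel R) A)
    {U : Fock (Semi θ) ≃ₗᵢ[ℂ] Fock (Semi τ)} (hU : ∀ x, U (ξ x) = rotatedHom hA x (ξ 1)) :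
    (normAlg (Semi θ)).map (conjAlgEquiv U).toAlgHom = normAlg (Semi τ) :=
  map_conjAlgEquiv_eq
    (normAlg_le_comap_conjAlgEquiv fun x => by
      rw [conjAlgEquiv_shift hA hU]; exact rotatedHom_mem_polyAlg hA x)
    (normAlg_le_comap_conjAlgEquiv (conjAlgEquiv_symm_shift_mem_polyAlg hA hU))

theorem map_wotAlg_eq (hA : ImplementsProductEquiv θ (τ.relabel R) A)
    {U : Fock (Semi θ) ≃ₗᵢ[ℂ] Fock (Semi τ)} (hU : ∀ x, U (ξ x) = rotatedHom hA x (ξ 1)) :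
    (wotAlg (Semi θ)).map (conjAlgEquiv U).toAlgHom = wotAlg (Semi τ) :=
  map_conjAlgEquiv_eq
    (wotAlg_le_comap_conjAlgEquiv fun x => by
      rw [conjAlgEquiv_shift hA hU]; exact rotatedHom_mem_polyAlg hA x)
    (wotAlg_le_comap_conjAlgEquiv (conjAlgEquiv_symm_shift_mem_polyAlg hA hU))

theorem multigradedlyIsometricallyIsomorphic_of_map_eq
    (hA : ImplementsProductEquiv θ (τ.relabel R) A)
    {U : Fock (Semi θ) ≃ₗᵢ[ℂ] Fock (Semi τ)} (hU : ∀ x, U (ξ x) = rotatedHom hA x (ξ 1))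
    {B : Subalgebra ℂ (Fock (Semi θ) →L[ℂ] Fock (Semi θ))}
    {C : Subalgebra ℂ (Fock (Semi τ) →L[ℂ] Fock (Semi τ))}
    (h : B.map (conjAlgEquiv U).toAlgHom = C) : MultigradedlyIsometricallyIsomorphic B C := by
  have key : ∀ (X : B) i k, (X : Fock (Semi θ) →L[ℂ] Fock (Semi θ)) = shift (gen θ i k) →
      conjAlgEquiv U X = rotatedShift τ R A i k := fun X i k hX => by
    rw [hX, conjAlgEquiv_shift hA hU, rotatedHom_gen]
  refine ⟨((conjAlgEquiv U).subalgebraMap B).trans (Subalgebra.equivOfEq _ _ h), ?_, ?_, R.σ, ?_⟩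
  · exact fun X Y => isometry_conjAlgEquiv U X Y
  · intro i k X hX
    change conjAlgEquiv U X ∈ _
    rw [key X i k hX]
    exact sum_mem fun l _ => Submodule.smul_mem _ _ (Submodule.subset_span ⟨_, _, rfl⟩)
  · intro i k X hX
    change conjAlgEquiv U X ∈ _
    rw [key X i k hX]
    exact sum_mem fun l _ => Submodule.smul_mem _ _ (Submodule.subset_span ⟨_, rfl⟩)

end Implemented

section Blocks

variable {r : ℕ} (n : Fin r → ℕ)

/-- Families indexed by the generators as families of vectors of the Euclidean spaces `ℂ^{n_i}`. -/
def blocks : (Gen n → ℂ) ≃ₗ[ℂ] ∀ i, EuclideanSpace ℂ (Fin (n i)) where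
  toFun α i := WithLp.toLp 2 fun k => α ⟨i, k⟩
  invFun w g := w g.1 g.2
  map_add' _ _ := rfl
  map_smul' _ _ := rfl
  left_inv _ := rfl
  right_inv _ := rfl

variable {n}

theorem norm_blocks_sq (α : Gen n → ℂ) (i : Fin r) :
    ‖blocks n α i‖ ^ 2 = ∑ k, ‖α ⟨i, k⟩‖ ^ 2 := by
  rw [EuclideanSpace.norm_sq_eq]
  rfl

end Blocks

/-! ### Points, their characters, and evaluation in each degree -/

section Points

variable {r : ℕ} {n : Fin r → ℕ} {θ : PermSet n}

/-- A family of scalars that satisfies the relations of `θ`. -/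
def IsPoint (θ : PermSet n) (α : Gen n → ℂ) : Prop :=
  ∀ (i j : Fin r) (h : i < j) (k : Fin (n i)) (l : Fin (n j)),
    α ⟨i, k⟩ * α ⟨j, l⟩ = α ⟨j, (θ i j h (k, l)).2⟩ * α ⟨i, (θ i j h (k, l)).1⟩

/-- The character of the semigroup given by a point. -/
def IsPoint.hom {α : Gen n → ℂ} (hα : IsPoint θ α) : Semi θ →* ℂ :=
  PresentedMonoid.lift α (by
    rintro _ _ ⟨i, j, h, k, l⟩
    simpa using hα i j h k l)

theorem IsPoint.hom_gen {α : Gen n → ℂ} (hα : IsPoint θ α) (i : Fin r) (k : Fin (n i)) :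
    hα.hom (gen θ i k) = α ⟨i, k⟩ := rfl

/-- The set of points is invariant under rescaling of the blocks. -/
theorem IsPoint.scale {α : Gen n → ℂ} (hα : IsPoint θ α) (t : Fin r → ℂ) :
    IsPoint θ fun g => t g.1 * α g := by
  intro i j h k l
  linear_combination (t i * t j) * hα i j h k l

/-- Families supported in one block are points. -/
theorem isPoint_of_support {α : Gen n → ℂ} {a : Fin r} (hα : ∀ g, g.1 ≠ a → α g = 0) :
    IsPoint θ α := by
  intro i j h k l
  by_cases hi : i = a
  · have hj : j ≠ a := fun e => h.ne (hi.trans e.symm)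
    rw [hα ⟨j, l⟩ hj, hα ⟨j, _⟩ hj]
    ring
  · rw [hα ⟨i, k⟩ hi, hα ⟨i, _⟩ hi]
    ring

/-- The finite set of elements of given multi-degree. -/
def ofMdeg (θ : PermSet n) (p : Fin r → ℕ) : Finset (Semi θ) := (finite_mdeg_eq p).toFinset

theorem mem_ofMdeg {p : Fin r → ℕ} {x : Semi θ} : x ∈ ofMdeg θ p ↔ mdeg x = p := by
  simp [ofMdeg]

/-- The finite set of elements of given total degree. -/
def ofTdeg (θ : PermSet n) (N : ℕ) : Finset (Semi θ) := (finite_tdeg_eq N).toFinset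

theorem mem_ofTdeg {N : ℕ} {x : Semi θ} : x ∈ ofTdeg θ N ↔ tdeg x = N := by
  simp [ofTdeg]

/-- Peeling off a first letter from a block `i` with `p i ≠ 0` covers degree `p` by products `e_{ik}
y`, so each peeling costs at most the factor `‖α_i‖² ≤ 1`. A covering is enough; the factorizations
need not be unique. -/
theorem IsPoint.sum_ofMdeg_le {α : Gen n → ℂ} (hα : IsPoint θ α) (h1 : ‖blocks n α‖ ≤ 1)
    (p : Fin r → ℕ) : ∑ x ∈ ofMdeg θ p, ‖hα.hom x‖ ^ 2 ≤ 1 := by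
  classical
  induction hN : ∑ i, p i generalizing p with
  | zero =>
    have : ofMdeg θ p ⊆ {1} := fun x hx => by
      rw [mem_ofMdeg] at hx
      exact Finset.mem_singleton.2 (eq_one_of_tdeg_eq_zero (by rw [tdeg, hx, hN]))
    exact (Finset.sum_le_sum_of_subset_of_nonneg this fun _ _ _ => by positivity).trans (by simp)
  | succ N ih =>
    obtain ⟨i, -, hi⟩ := Finset.exists_ne_zero_of_sum_ne_zero (hN.trans_ne N.succ_ne_zero)
    set q := p - Pi.single i 1 with hq
    have hp : p = Pi.single i 1 + q := by
      funext j
      by_cases hj : j = i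
      · subst hj; simp [hq]; omega
      · simp [hq, hj]
    have hqN : ∑ j, q j = N := by
      rw [hp] at hN
      simp [Finset.sum_add_distrib, Finset.sum_pi_single'] at hN
      omega
    have hsub : ofMdeg θ p ⊆ (Finset.univ ×ˢ ofMdeg θ q).image fun a => gen θ i a.1 * a.2 := by
      intro x hx
      rw [mem_ofMdeg] at hx
      obtain ⟨k, y, rfl⟩ := exists_eq_gen_mul (x := x) (i := i) (by rwa [hx])
      rw [mdeg_mul, mdeg_gen, hp] at hx
      exact Finset.mem_image.2 ⟨(k, y), by simp [mem_ofMdeg, add_left_cancel hx], rfl⟩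
    have hi1 : ‖blocks n α i‖ ^ 2 ≤ 1 :=
      pow_le_one₀ (norm_nonneg _) ((norm_le_pi_norm _ i).trans h1)
    calc ∑ x ∈ ofMdeg θ p, ‖hα.hom x‖ ^ 2
        ≤ ∑ x ∈ (Finset.univ ×ˢ ofMdeg θ q).image fun a => gen θ i a.1 * a.2,
            ‖hα.hom x‖ ^ 2 :=
          Finset.sum_le_sum_of_subset_of_nonneg hsub fun _ _ _ => by positivity
      _ ≤ ∑ a ∈ Finset.univ ×ˢ ofMdeg θ q, ‖hα.hom (gen θ i a.1 * a.2)‖ ^ 2 :=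
          Finset.sum_image_le_of_nonneg fun _ _ => by positivity
      _ = ‖blocks n α i‖ ^ 2 * ∑ x ∈ ofMdeg θ q, ‖hα.hom x‖ ^ 2 := by
          rw [Finset.sum_product, norm_blocks_sq, Finset.sum_mul_sum]
          simp only [map_mul, norm_mul, mul_pow, hα.hom_gen]
      _ ≤ 1 * 1 := mul_le_mul hi1 (ih q hqN) (by positivity) zero_le_one
      _ = 1 := one_mul 1

/-- At most `(N + 1) ^ r` multi-degrees have total degree `N`. Only the polynomial growth in `N`
matters later. -/
theorem IsPoint.sum_ofTdeg_le {α : Gen n → ℂ} (hα : IsPoint θ α) (h1 : ‖blocks n α‖ ≤ 1)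
    (N : ℕ) : ∑ x ∈ ofTdeg θ N, ‖hα.hom x‖ ^ 2 ≤ ((N : ℝ) + 1) ^ r := by
  classical
  let P : Finset (Fin r → ℕ) := Fintype.piFinset fun _ => Finset.range (N + 1)
  have hmaps : ∀ x ∈ ofTdeg θ N, mdeg x ∈ P := fun x hx => by
    rw [mem_ofTdeg] at hx
    simp only [P, Fintype.mem_piFinset, Finset.mem_range]
    intro i
    have : mdeg x i ≤ tdeg x :=
      Finset.single_le_sum (f := mdeg x) (fun _ _ => Nat.zero_le _) (Finset.mem_univ i)
    omega
  rw [← Finset.sum_fiberwise_of_maps_to hmaps]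
  calc ∑ p ∈ P, ∑ x ∈ ofTdeg θ N with mdeg x = p, ‖hα.hom x‖ ^ 2
      ≤ ∑ p ∈ P, 1 := by
        refine Finset.sum_le_sum fun p _ => le_trans ?_ (hα.sum_ofMdeg_le h1 p)
        refine Finset.sum_le_sum_of_subset_of_nonneg (fun x hx => ?_) fun _ _ _ => by positivity
        exact mem_ofMdeg.2 (Finset.mem_filter.1 hx).2
    _ = ((N : ℝ) + 1) ^ r := by simp [P, Fintype.card_piFinset]

/-- The value of the character of a point on the homogeneous part of degree `N` of a vector. -/
def IsPoint.eval {α : Gen n → ℂ} (hα : IsPoint θ α) (N : ℕ) (x : Fock (Semi θ)) : ℂ :=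
  ∑ w ∈ ofTdeg θ N, hα.hom w * x w

theorem IsPoint.eval_zero_ξ {α : Gen n → ℂ} (hα : IsPoint θ α) :
    hα.eval 0 (ξ 1) = 1 := by
  have : ofTdeg θ 0 = {1} := by
    ext x
    rw [mem_ofTdeg, Finset.mem_singleton]
    exact ⟨eq_one_of_tdeg_eq_zero, fun h => by rw [h, tdeg_one]⟩
  simp [IsPoint.eval, this, ξ_apply_self]

theorem IsPoint.norm_eval_sq_le {α : Gen n → ℂ} (hα : IsPoint θ α) (h1 : ‖blocks n α‖ ≤ 1)
    (N : ℕ) (x : Fock (Semi θ)) : ‖hα.eval N x‖ ^ 2 ≤ ((N : ℝ) + 1) ^ r * ‖x‖ ^ 2 := by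
  have h2 : ‖hα.eval N x‖ ≤ ∑ w ∈ ofTdeg θ N, ‖hα.hom w‖ * ‖x w‖ :=
    (norm_sum_le _ _).trans_eq (Finset.sum_congr rfl fun _ _ => norm_mul _ _)
  have h3 : ∑ w ∈ ofTdeg θ N, ‖x w‖ ^ 2 ≤ ‖x‖ ^ 2 := by
    simpa only [inner_ξ] using
      (orthonormal_ξ (S := Semi θ)).sum_inner_products_le x (s := ofTdeg θ N)
  calc ‖hα.eval N x‖ ^ 2 ≤ (∑ w ∈ ofTdeg θ N, ‖hα.hom w‖ * ‖x w‖) ^ 2 := by gcongr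
    _ ≤ (∑ w ∈ ofTdeg θ N, ‖hα.hom w‖ ^ 2) * ∑ w ∈ ofTdeg θ N, ‖x w‖ ^ 2 :=
        Finset.sum_mul_sq_le_sq_mul_sq _ _ _
    _ ≤ ((N : ℝ) + 1) ^ r * ‖x‖ ^ 2 :=
        mul_le_mul (hα.sum_ofTdeg_le h1 N) h3 (by positivity) (by positivity)

variable [IsLeftCancelMul (Semi θ)]

/-- A linear combination of the generating isometries. -/
def linOp (θ : PermSet n) [IsLeftCancelMul (Semi θ)] (y : Gen n → ℂ) :
    Fock (Semi θ) →L[ℂ] Fock (Semi θ) :=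
  ∑ g, y g • shift (gen θ g.1 g.2)

theorem linOp_single (g : Gen n) : linOp θ (Pi.single g 1) = shift (gen θ g.1 g.2) := by
  classical
  rw [linOp, Finset.sum_eq_single g]
  · simp
  · intro b _ hb; simp [hb]
  · simp

theorem IsPoint.eval_shift {α : Gen n → ℂ} (hα : IsPoint θ α) (N : ℕ) (x : Fock (Semi θ))
    (g : Gen n) : hα.eval (N + 1) (shift (gen θ g.1 g.2) x) = α g * hα.eval N x := by
  classical
  have hsub : ((ofTdeg θ N).image fun v => gen θ g.1 g.2 * v) ⊆ ofTdeg θ (N + 1) := by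
    intro w hw
    obtain ⟨v, hv, rfl⟩ := Finset.mem_image.1 hw
    rw [mem_ofTdeg] at hv ⊢
    rw [tdeg_mul, tdeg_gen, hv, add_comm]
  rw [IsPoint.eval, ← Finset.sum_subset hsub, Finset.sum_image, IsPoint.eval, Finset.mul_sum]
  · refine Finset.sum_congr rfl fun v _ => ?_
    rw [map_mul, hα.hom_gen, shift_apply_mul]
    ring
  · intro v _ w _ h
    exact mul_left_cancel h
  · intro w hw hw'
    rw [shift_apply_of_forall_ne, mul_zero]
    rintro v rfl
    refine hw' (Finset.mem_image.2 ⟨v, ?_, rfl⟩)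
    rw [mem_ofTdeg] at hw ⊢
    rw [tdeg_mul, tdeg_gen] at hw
    omega

theorem IsPoint.eval_linOp {α : Gen n → ℂ} (hα : IsPoint θ α) (N : ℕ) (x : Fock (Semi θ))
    (y : Gen n → ℂ) : hα.eval (N + 1) (linOp θ y x) = (y ⬝ᵥ α) * hα.eval N x := by
  have h : hα.eval (N + 1) (linOp θ y x) =
      ∑ g, y g * hα.eval (N + 1) (shift (gen θ g.1 g.2) x) := by
    simp only [IsPoint.eval, Finset.mul_sum]
    rw [Finset.sum_comm]
    refine Finset.sum_congr rfl fun w _ => ?_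
    rw [linOp, sum_apply]
    simp only [lp.coeFn_sum, Finset.sum_apply, Finset.mul_sum]
    refine Finset.sum_congr rfl fun g _ => ?_
    simp only [smul_apply, lp.coeFn_smul, Pi.smul_apply, smul_eq_mul]
    ring
  rw [h, dotProduct, Finset.sum_mul]
  refine Finset.sum_congr rfl fun g _ => ?_
  rw [hα.eval_shift]
  ring

theorem IsPoint.eval_linOp_pow {α : Gen n → ℂ} (hα : IsPoint θ α) (N : ℕ) (y : Gen n → ℂ) :
    hα.eval N ((linOp θ y ^ N) (ξ 1)) = (y ⬝ᵥ α) ^ N := by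
  induction N with
  | zero => simp [hα.eval_zero_ξ]
  | succ N ih =>
    rw [pow_succ', mul_apply_eq_comp, hα.eval_linOp, ih, pow_succ']

end Points

/-- A sequence of powers is not dominated by smaller powers times polynomial factors. -/
theorem le_of_forall_pow_le {a b : ℝ} (hb : 0 ≤ b) (r : ℕ)
    (h : ∀ N : ℕ, a ^ N ≤ ((N : ℝ) + 1) ^ r * b ^ N) : a ≤ b := by
  by_contra! hab
  have ha' : 0 < a := hb.trans_lt hab
  have hq : |b / a| < 1 := by
    rw [abs_of_nonneg (by positivity), div_lt_one ha']
    exact hab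
  have h1 := (tendsto_pow_const_mul_const_pow_of_abs_lt_one r hq).comp
    (Filter.tendsto_add_atTop_nat 1)
  -- The extra factor `b / a` aligns the polynomial and the exponent at `N + 1`, matching the known
  -- limit 0. The conclusion is then only `b / a ≤ 0`, so `b = 0`, and the case `N = 1` of the
  -- hypothesis finishes.
  have h2 : ∀ N : ℕ, b / a ≤ ((N + 1 : ℕ) : ℝ) ^ r * (b / a) ^ (N + 1) := fun N => by
    have h3 : 1 ≤ ((N : ℝ) + 1) ^ r * (b / a) ^ N := by
      rw [div_pow, ← mul_div_assoc, one_le_div (by positivity)]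
      exact h N
    have h4 := mul_le_mul_of_nonneg_right h3 (show 0 ≤ b / a by positivity)
    rw [one_mul] at h4
    push_cast
    rw [pow_succ, ← mul_assoc]
    exact h4
  have h3 : b / a ≤ 0 := ge_of_tendsto h1 (Filter.Eventually.of_forall h2)
  have h4 : b = 0 := by
    rcases (div_nonpos_iff.1 h3) with h | h
    · linarith
    · linarith
  have := h 1
  rw [h4] at this
  norm_num at this
  linarith

/-! ### Contractive action of graded maps on points -/

section Contractive

variable {r s : ℕ} {n : Fin r → ℕ} {m : Fin s → ℕ} {θ : PermSet n} {τ : PermSet m}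
  [IsLeftCancelMul (Semi θ)] [IsLeftCancelMul (Semi τ)]

/-- For `‖blocks n α‖ ≤ 1`, evaluating `(linOp θ y) ^ N ξ_1` in degree `N` gives `|y ⬝ᵥ α| ^ (2N) ≤
(N + 1) ^ r ‖linOp θ y‖ ^ (2N)`, and the polynomial factor is lost on taking `N`-th roots. Working
in one degree at a time admits points of norm exactly 1, so homogeneity in `α` gives the general
bound. -/
theorem IsPoint.norm_dotProduct_le {α : Gen n → ℂ} (hα : IsPoint θ α) (y : Gen n → ℂ) :
    ‖y ⬝ᵥ α‖ ≤ ‖linOp θ y‖ * ‖blocks n α‖ := by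
  have key : ∀ {α : Gen n → ℂ} (_ : IsPoint θ α) (_ : ‖blocks n α‖ ≤ 1),
      ‖y ⬝ᵥ α‖ ≤ ‖linOp θ y‖ := by
    intro α hα h1
    refine le_of_sq_le_sq ?_ (norm_nonneg _)
    refine le_of_forall_pow_le (by positivity) r fun N => ?_
    have h2 := hα.norm_eval_sq_le h1 N ((linOp θ y ^ N) (ξ 1))
    rw [hα.eval_linOp_pow, norm_pow, ← pow_mul, mul_comm N 2, pow_mul] at h2
    refine h2.trans (mul_le_mul_of_nonneg_left ?_ (by positivity))
    have h3 : ‖(linOp θ y ^ N) (ξ 1)‖ ≤ ‖linOp θ y‖ ^ N := by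
      refine ((linOp θ y ^ N).le_opNorm _).trans ?_
      rw [orthonormal_ξ.1, mul_one]
      have : Nontrivial (Fock (Semi θ)) :=
        ⟨ξ 1, 0, fun h => by simpa [h] using orthonormal_ξ.1 (1 : Semi θ)⟩
      exact norm_pow_le _ _
    calc ‖(linOp θ y ^ N) (ξ 1)‖ ^ 2 ≤ (‖linOp θ y‖ ^ N) ^ 2 := by gcongr
      _ = (‖linOp θ y‖ ^ 2) ^ N := by ring
  rcases eq_or_ne α 0 with rfl | h0
  · simp
  · have hb : 0 < ‖blocks n α‖ := norm_pos_iff.2 (by simpa using h0)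
    set c : ℂ := ((‖blocks n α‖⁻¹ : ℝ) : ℂ) with hc
    have hcn : ‖c‖ = ‖blocks n α‖⁻¹ := by
      rw [hc, Complex.norm_real, Real.norm_of_nonneg (by positivity)]
    have h1 := key (α := c • α) (hα.scale fun _ => c) (by
      rw [map_smul, norm_smul, hcn, inv_mul_cancel₀ hb.ne'])
    rw [dotProduct_smul, norm_smul, hcn, inv_mul_le_iff₀ hb] at h1
    linarith

/-- The shifts of one block are isometries with pairwise orthogonal ranges, so Pythagoras applies.
-/
theorem norm_sum_smul_shift_gen_le (i : Fin r) (c : EuclideanSpace ℂ (Fin (n i))) :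
    ‖∑ k, c k • shift (gen θ i k)‖ ≤ ‖c‖ := by
  refine ContinuousLinearMap.opNorm_le_bound _ (norm_nonneg _) fun x => ?_
  refine le_of_sq_le_sq (le_of_eq ?_) (by positivity)
  have h : ∀ k l, inner ℂ (shift (gen θ i k) x) (shift (gen θ i l) x) =
      if k = l then ((‖x‖ ^ 2 : ℝ) : ℂ) else 0 := fun k l => by
    split_ifs with hkl
    · subst hkl
      rw [inner_shift_shift_self, inner_self_eq_norm_sq_to_K]
      norm_cast
    · exact inner_shift_shift_of_forall_ne (fun w w' => gen_mul_ne_gen_mul hkl w w') x x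
  have h2 : (((‖(∑ k, c k • shift (gen θ i k)) x‖ ^ 2 : ℝ)) : ℂ) =
      ((∑ k, ‖c k‖ ^ 2 * ‖x‖ ^ 2 : ℝ) : ℂ) := by
    have h3 : ∀ v : Fock (Semi θ), ((‖v‖ ^ 2 : ℝ) : ℂ) = inner ℂ v v := fun v => by
      rw [inner_self_eq_norm_sq_to_K]; norm_cast
    rw [h3, sum_apply, sum_inner, Complex.ofReal_sum]
    refine Finset.sum_congr rfl fun k _ => ?_
    rw [inner_sum, Finset.sum_eq_single k]
    · simp only [smul_apply, inner_smul_left, inner_smul_right, h, if_true]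
      rw [← mul_assoc, Complex.mul_conj']
      push_cast
      ring
    · intro l _ hl
      simp only [smul_apply, inner_smul_left, inner_smul_right, h,
        if_neg hl.symm, mul_zero]
    · simp
  rw [Complex.ofReal_inj] at h2
  rw [h2, mul_pow, EuclideanSpace.norm_sq_eq, Finset.sum_mul]

/-- The matrix `B` maps generators of `𝔽_θ⁺` to linear combinations of generating isometries that
satisfy the relations of `θ`, contractively. -/
structure IsContractiveRep (θ : PermSet n) (τ : PermSet m) [IsLeftCancelMul (Semi θ)]
    [IsLeftCancelMul (Semi τ)] (B : Matrix (Gen n) (Gen m) ℂ) : Prop where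
  rel : ∀ (i j : Fin r) (h : i < j) (k : Fin (n i)) (l : Fin (n j)),
    linOp τ (B ⟨i, k⟩) * linOp τ (B ⟨j, l⟩) =
      linOp τ (B ⟨j, (θ i j h (k, l)).2⟩) * linOp τ (B ⟨i, (θ i j h (k, l)).1⟩)
  norm_le : ∀ c : Gen n → ℂ, ‖linOp τ (c ᵥ* B)‖ ≤ ‖linOp θ c‖

variable {B : Matrix (Gen n) (Gen m) ℂ}

/-- Evaluation at `α` in degree two is multiplicative on products of two combinations of generators,
so it turns the operator relations into scalar ones. -/
theorem IsContractiveRep.isPoint (hB : IsContractiveRep θ τ B) {α : Gen m → ℂ}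
    (hα : IsPoint τ α) : IsPoint θ (B *ᵥ α) := by
  intro i j h k l
  have h1 : ∀ e e' : Gen n, hα.eval 2 ((linOp τ (B e) * linOp τ (B e')) (ξ 1)) =
      (B *ᵥ α) e * (B *ᵥ α) e' := fun e e' => by
    rw [mul_apply_eq_comp, hα.eval_linOp 1, hα.eval_linOp 0, hα.eval_zero_ξ, mul_one]
    rfl
  rw [← h1, ← h1, hB.rel]

/-- Duality: let `β = B *ᵥ α` and let `c` be the conjugate of its block `i`, extended by zero. Then
`‖β_i‖² = (c ᵥ* B) ⬝ᵥ α ≤ ‖linOp τ (c ᵥ* B)‖ ‖α‖ ≤ ‖linOp θ c‖ ‖α‖ ≤ ‖β_i‖ ‖α‖`, with the block norm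
of `α`. -/
theorem IsContractiveRep.norm_blocks_le (hB : IsContractiveRep θ τ B) {α : Gen m → ℂ}
    (hα : IsPoint τ α) : ‖blocks n (B *ᵥ α)‖ ≤ ‖blocks m α‖ := by
  classical
  refine (pi_norm_le_iff_of_nonneg (norm_nonneg _)).2 fun i => ?_
  set β := B *ᵥ α with hβ
  let c : Gen n → ℂ := fun g => if g.1 = i then star (β g) else 0
  have h1 : c ⬝ᵥ β = ((‖blocks n β i‖ ^ 2 : ℝ) : ℂ) := by
    rw [norm_blocks_sq, dotProduct, Fintype.sum_sigma, Finset.sum_eq_single i]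
    · push_cast
      refine Finset.sum_congr rfl fun k _ => ?_
      simp only [c, if_true]
      exact Complex.conj_mul' _
    · intro j _ hj
      simp [c, hj]
    · simp
  have h2 : ‖linOp θ c‖ ≤ ‖blocks n β i‖ := by
    have h3 : linOp θ c =
        ∑ k, (WithLp.toLp 2 fun k => star (β ⟨i, k⟩) : EuclideanSpace ℂ (Fin (n i))) k •
          shift (gen θ i k) := by
      rw [linOp, Fintype.sum_sigma, Finset.sum_eq_single i]
      · simp [c]
      · intro j _ hj
        simp [c, hj]
      · simp
    rw [h3]
    refine (norm_sum_smul_shift_gen_le i _).trans (le_of_sq_le_sq ?_ (norm_nonneg _))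
    rw [norm_blocks_sq, EuclideanSpace.norm_sq_eq]
    simp
  have h3 := hα.norm_dotProduct_le (c ᵥ* B)
  rw [← Matrix.dotProduct_mulVec, ← hβ, h1, Complex.norm_real,
    Real.norm_of_nonneg (by positivity)] at h3
  have h4 : ‖blocks n β i‖ ^ 2 ≤ ‖blocks n β i‖ * ‖blocks m α‖ :=
    h3.trans (mul_le_mul_of_nonneg_right ((hB.norm_le c).trans h2) (norm_nonneg _))
  rcases (norm_nonneg (blocks n β i)).eq_or_lt with h0 | h0
  · rw [← h0]; exact norm_nonneg _
  · rw [sq] at h4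
    exact le_of_mul_le_mul_left h4 h0

end Contractive

/-! ### Geometry of maximum norm sums of Hilbert spaces -/

section Axis

theorem exists_norm_apply_eq {r : ℕ} {X : Fin r → Type*} [∀ i, NormedAddCommGroup (X i)]
    {w : ∀ i, X i} (hw : w ≠ 0) : ∃ i, ‖w i‖ = ‖w‖ := by
  by_contra! h
  have := (pi_norm_lt_iff (norm_pos_iff.2 hw)).2 fun i => (norm_le_pi_norm w i).lt_of_ne (h i)
  exact lt_irrefl _ this

/-- In a maximum norm sum of Hilbert spaces a vector whose rescalings are mapped isometrically,
and which itself is mapped into one of the summands, lies in one of the summands. -/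
theorem eq_zero_or_eq_zero_of_norm_map_smul {r s : ℕ} {X : Fin r → Type*} {Y : Fin s → Type*}
    [∀ i, NormedAddCommGroup (X i)] [∀ i, InnerProductSpace ℂ (X i)]
    [∀ j, NormedAddCommGroup (Y j)] [∀ j, InnerProductSpace ℂ (Y j)]
    (T : (∀ i, X i) →ₗ[ℂ] ∀ j, Y j) (w : ∀ i, X i)
    (hT : ∀ t : Fin r → ℂ, ‖T fun i => t i • w i‖ = ‖fun i => t i • w i‖) {j : Fin s}
    (hj : ∀ l, l ≠ j → T w l = 0) {i i' : Fin r} (hii' : i ≠ i') : w i = 0 ∨ w i' = 0 := by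
  by_contra! hne
  obtain ⟨hi, hi'⟩ := hne
  have hw : w ≠ 0 := fun h => hi (congrFun h i)
  have ha : 0 < ‖w‖ := norm_pos_iff.2 hw
  obtain ⟨i₀, hi₀⟩ := exists_norm_apply_eq hw
  -- `w` is split into a component `i₀` of maximal norm and the rest `v`, with images `β` and `γ`.
  -- Every combination `x • β + y • γ` is the image of a block rescaling of `w`, so its norm is
  -- known.
  let c : ℂ → ℂ → Fin r → ℂ := fun x y a => if a = i₀ then x else y
  set v : ∀ a, X a := fun a => c 0 1 a • w a with hv
  set g := ‖v‖ with hg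
  have hg0 : 0 < g := by
    refine norm_pos_iff.2 fun h0 => ?_
    by_cases h : i = i₀
    · have := congrFun h0 i'
      simp [hv, c, show i' ≠ i₀ from fun e => hii' (h.trans e.symm), hi'] at this
    · have := congrFun h0 i
      simp [hv, c, h, hi] at this
  have hga : g ≤ ‖w‖ := by
    refine (pi_norm_le_iff_of_nonneg ha.le).2 fun a => ?_
    by_cases h : a = i₀
    · simp [hv, c, h]
    · simpa [hv, c, h] using norm_le_pi_norm w a
  have hnorm : ∀ x y : ℂ, ‖fun a => c x y a • w a‖ ≤ max (‖x‖ * ‖w‖) (‖y‖ * g) := fun x y => by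
    refine (pi_norm_le_iff_of_nonneg (le_max_of_le_left (by positivity))).2 fun a => ?_
    by_cases h : a = i₀
    · subst h
      simp [c, norm_smul, hi₀]
    · have h2 : ‖w a‖ ≤ g := by
        have := norm_le_pi_norm v a
        have h3 : v a = w a := by simp [hv, c, h]
        rwa [h3] at this
      simp only [c, h, if_false, norm_smul]
      exact le_max_of_le_right (by gcongr)
  set β := T fun a => c 1 0 a • w a with hβ
  set γ := T v with hγ
  have hlin : ∀ x y : ℂ, (T fun a => c x y a • w a) = x • β + y • γ := fun x y => by
    rw [hβ, hγ, ← map_smul, ← map_smul, ← map_add]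
    congr 1
    funext a
    by_cases h : a = i₀ <;> simp [hv, c, h]
  have hle : ∀ (x y : ℂ) (l : Fin s), ‖x • β l + y • γ l‖ ≤ max (‖x‖ * ‖w‖) (‖y‖ * g) :=
    fun x y l => by
      have h1 := norm_le_pi_norm (x • β + y • γ) l
      rw [← hlin, hT] at h1
      have h2 := h1.trans (hnorm x y)
      rw [hlin] at h2
      exact h2
  have hsum : ∀ l, l ≠ j → γ l = -β l := fun l hl => by
    have h1 := hj l hl
    have h2 : w = fun a => c 1 1 a • w a := by funext a; simp [c]
    rw [h2, hlin] at h1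
    simp only [one_smul, Pi.add_apply] at h1
    exact (neg_eq_of_add_eq_zero_right h1).symm
  have hβn : ‖β‖ = ‖w‖ := by
    refine le_antisymm ((hT _).trans_le (by simpa using hnorm 1 0)) ?_
    rw [hβ, hT]
    have := norm_le_pi_norm (fun a => c 1 0 a • w a) i₀
    simpa [c, hi₀] using this
  have hγn : ‖γ‖ = g := hT _
  -- In a summand `l ≠ j` one has `γ l = -β l`. If `β` attained its norm there, `β - γ` would have
  -- norm `2 ‖w‖`, above the bound `‖w‖`.
  have hβj : ‖β j‖ = ‖w‖ := by
    obtain ⟨l, hl⟩ := exists_norm_apply_eq (w := β) (norm_pos_iff.1 (by rw [hβn]; exact ha))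
    by_cases h : l = j
    · rw [← h, hl, hβn]
    · exfalso
      have h1 := hle 1 (-1) l
      rw [hsum l h] at h1
      have h2 : (1 : ℂ) • β l + (-1 : ℂ) • -β l = (2 : ℂ) • β l := by module
      rw [h2, norm_smul, hl, hβn] at h1
      simp only [norm_one, one_mul, norm_neg, max_eq_left hga, Complex.norm_ofNat] at h1
      linarith
  -- `β j` already has the maximal norm allowed for `β j ± γ j`, so the parallelogram law leaves no
  -- room for `γ j`.
  have hγj : γ j = 0 := by
    have h1 := hle 1 1 j
    have h2 := hle 1 (-1) j
    simp only [norm_one, one_mul, norm_neg, max_eq_left hga, one_smul, neg_smul] at h1 h2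
    rw [← sub_eq_add_neg] at h2
    have h3 := parallelogram_law_with_norm ℂ (β j) (γ j)
    rw [hβj] at h3
    have h4 : ‖γ j‖ = 0 := by
      nlinarith [norm_nonneg (γ j), norm_nonneg (β j + γ j), norm_nonneg (β j - γ j)]
    exact norm_eq_zero.1 h4
  obtain ⟨l, hl⟩ := exists_norm_apply_eq (w := γ) (norm_pos_iff.1 (by rw [hγn]; exact hg0))
  have hlj : l ≠ j := by
    rintro rfl
    rw [hγj, norm_zero, hγn] at hl
    exact hg0.ne hl
  -- `γ` attains its norm `g` in a summand where `β l = -γ l`. Scaling `γ` by `-‖w‖ / g`, the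
  -- largest modulus that keeps the bound at `‖w‖`, gives norm `g + ‖w‖` there, a contradiction.
  have h1 := hle 1 (-((‖w‖ / g : ℝ) : ℂ)) l
  have h2 : β l = -γ l := by rw [hsum l hlj, neg_neg]
  have h3 : (1 : ℂ) • -γ l + (-((‖w‖ / g : ℝ) : ℂ)) • γ l =
      (-((1 + ‖w‖ / g : ℝ) : ℂ)) • γ l := by
    push_cast
    module
  rw [h2, h3, norm_smul, hl, hγn, norm_neg, norm_neg, Complex.norm_real, Complex.norm_real,
    Real.norm_of_nonneg (by positivity), Real.norm_of_nonneg (by positivity), norm_one, one_mul,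
    div_mul_cancel₀ _ hg0.ne', max_self, add_mul, div_mul_cancel₀ _ hg0.ne'] at h1
  linarith

end Axis

/-! ### Bijection of the blocks and unitary matrices -/

section Relabeling

variable {r s : ℕ} {n : Fin r → ℕ} {m : Fin s → ℕ} {θ : PermSet n} {τ : PermSet m}
  [IsLeftCancelMul (Semi θ)] [IsLeftCancelMul (Semi τ)]
  {B : Matrix (Gen n) (Gen m) ℂ} {B' : Matrix (Gen m) (Gen n) ℂ}

theorem IsContractiveRep.norm_blocks_eq (hB : IsContractiveRep θ τ B)
    (hB' : IsContractiveRep τ θ B') (h : B' * B = 1) {α : Gen m → ℂ} (hα : IsPoint τ α) :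
    ‖blocks n (B *ᵥ α)‖ = ‖blocks m α‖ := by
  refine le_antisymm (hB.norm_blocks_le hα) ?_
  have := hB'.norm_blocks_le (hB.isPoint hα)
  rwa [Matrix.mulVec_mulVec, h, Matrix.one_mulVec] at this

/-- The geometric lemma is applied to the inverse matrix `B'` at `B *ᵥ α`: rescalings of this point
are points, hence mapped isometrically, and `B'` brings it back into the single block `a`. -/
theorem IsContractiveRep.mulVec_block_eq_zero (hB : IsContractiveRep θ τ B)
    (hB' : IsContractiveRep τ θ B') (h : B * B' = 1) (h' : B' * B = 1) {α : Gen m → ℂ}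
    {a : Fin s} (hα : ∀ g, g.1 ≠ a → α g = 0) {i i' : Fin r} (hi : i ≠ i') :
    (∀ k, (B *ᵥ α) ⟨i, k⟩ = 0) ∨ ∀ k, (B *ᵥ α) ⟨i', k⟩ = 0 := by
  let T : (∀ i, EuclideanSpace ℂ (Fin (n i))) →ₗ[ℂ] ∀ j, EuclideanSpace ℂ (Fin (m j)) :=
    (blocks m).toLinearMap ∘ₗ B'.mulVecLin ∘ₗ (blocks n).symm.toLinearMap
  have hT : ∀ w, T (blocks n w) = blocks m (B' *ᵥ w) := fun w => by simp [T]
  have hpt := hB.isPoint (isPoint_of_support (θ := τ) hα)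
  have h1 := eq_zero_or_eq_zero_of_norm_map_smul T (blocks n (B *ᵥ α))
    (fun t => by
      have e : (fun i => t i • blocks n (B *ᵥ α) i) =
        blocks n (fun g => t g.1 * (B *ᵥ α) g) := rfl
      rw [e, hT]
      exact hB'.norm_blocks_eq hB h (hpt.scale t))
    (j := a) (fun l hl => by
      rw [hT, Matrix.mulVec_mulVec, h', Matrix.one_mulVec]
      ext k
      exact hα ⟨l, k⟩ hl) hi
  refine h1.imp (fun h2 k => ?_) fun h2 k => ?_
  · exact congrArg (fun x : EuclideanSpace ℂ (Fin (n i)) => x k) h2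
  · exact congrArg (fun x : EuclideanSpace ℂ (Fin (n i')) => x k) h2

theorem IsContractiveRep.exists_block (hB : IsContractiveRep θ τ B)
    (hB' : IsContractiveRep τ θ B') (h : B * B' = 1) (h' : B' * B = 1) {a : Fin s}
    (ha : 1 ≤ m a) : ∃ i, ∀ g l, B g ⟨a, l⟩ ≠ 0 → g.1 = i := by
  classical
  have hne : ∃ g l, B g ⟨a, l⟩ ≠ 0 := by
    by_contra! h0
    have h1 := congrFun (congrFun h' ⟨a, ⟨0, ha⟩⟩) ⟨a, ⟨0, ha⟩⟩
    simp [Matrix.mul_apply, h0] at h1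
  obtain ⟨g₀, l₀, h0⟩ := hne
  refine ⟨g₀.1, fun g l hgl => ?_⟩
  by_contra hg
  have key : ∀ α : Gen m → ℂ, (∀ g, g.1 ≠ a → α g = 0) →
      (B *ᵥ α) g = 0 ∨ (B *ᵥ α) g₀ = 0 := fun α hα =>
    (hB.mulVec_block_eq_zero hB' h h' hα hg).imp (fun h => h g.2) fun h => h g₀.2
  have hs : ∀ (l : Fin (m a)) (b : Gen m), b.1 ≠ a →
      (Pi.single (⟨a, l⟩ : Gen m) (1 : ℂ) : Gen m → ℂ) b = 0 := fun l b hb =>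
    Pi.single_eq_of_ne (fun e => hb (by rw [e])) _
  have h1 : B g ⟨a, l₀⟩ = 0 := by
    rcases key _ (hs l₀) with h | h
    · simpa using h
    · simp [h0] at h
  have h2 : B g₀ ⟨a, l⟩ = 0 := by
    rcases key _ (hs l) with h | h
    · simp [hgl] at h
    · simpa using h
  -- No space is the union of two proper subspaces: the image of this sum is nonzero at both `g` and
  -- `g₀`.
  have h3 := key (Pi.single (⟨a, l₀⟩ : Gen m) 1 + Pi.single (⟨a, l⟩ : Gen m) 1)
    fun b hb => by rw [Pi.add_apply, hs l₀ b hb, hs l b hb, add_zero]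
  simp [Matrix.mulVec_add, h1, h2, h0, hgl] at h3

/-- The bijection of the blocks induced by a bijective isometric graded map. -/
theorem IsContractiveRep.exists_equiv (hB : IsContractiveRep θ τ B)
    (hB' : IsContractiveRep τ θ B') (h : B * B' = 1) (h' : B' * B = 1)
    (hn : ∀ i, 1 ≤ n i) (hm : ∀ j, 1 ≤ m j) :
    ∃ σ : Fin r ≃ Fin s, (∀ e g, B e g ≠ 0 → g.1 = σ e.1) ∧ ∀ g e, B' g e ≠ 0 → g.1 = σ e.1 := by
  choose f hf using fun j => hB.exists_block hB' h h' (hm j)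
  choose f' hf' using fun i => hB'.exists_block hB h' h (hn i)
  -- A diagonal entry of `B * B' = 1` has a nonzero summand, whose middle index lies in a block `j`
  -- with `f j = i` and `f' i = j`.
  have h1 : ∀ i, f (f' i) = i := fun i => by
    have e := congrFun (congrFun h ⟨i, ⟨0, hn i⟩⟩) ⟨i, ⟨0, hn i⟩⟩
    rw [Matrix.mul_apply, Matrix.one_apply_eq] at e
    obtain ⟨⟨j, l⟩, -, hg⟩ := Finset.exists_ne_zero_of_sum_ne_zero (e.trans_ne one_ne_zero)
    have e1 := hf j _ _ (left_ne_zero_of_mul hg)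
    have e2 := hf' i _ _ (right_ne_zero_of_mul hg)
    simp only at e1 e2
    rw [← e2, ← e1]
  have h2 : ∀ j, f' (f j) = j := fun j => by
    have e := congrFun (congrFun h' ⟨j, ⟨0, hm j⟩⟩) ⟨j, ⟨0, hm j⟩⟩
    rw [Matrix.mul_apply, Matrix.one_apply_eq] at e
    obtain ⟨⟨i, l⟩, -, hg⟩ := Finset.exists_ne_zero_of_sum_ne_zero (e.trans_ne one_ne_zero)
    have e1 := hf' i _ _ (left_ne_zero_of_mul hg)
    have e2 := hf j _ _ (right_ne_zero_of_mul hg)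
    simp only at e1 e2
    rw [← e2, ← e1]
  refine ⟨⟨f', f, h1, h2⟩, fun e g heg => ?_, fun g e hge => hf' e.1 g e.2 hge⟩
  have : e.1 = f g.1 := hf g.1 e g.2 heg
  rw [Equiv.coe_fn_mk, this, h2]

theorem mem_unitaryGroup_of_norm_mulVec {N : ℕ} {A : Matrix (Fin N) (Fin N) ℂ}
    (h : ∀ a : Fin N → ℂ, ∑ k, ‖(A *ᵥ a) k‖ ^ 2 = ∑ k, ‖a k‖ ^ 2) :
    A ∈ Matrix.unitaryGroup (Fin N) ℂ := by
  rw [Matrix.mem_unitaryGroup_iff']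
  let T := Matrix.toEuclideanCLM (n := Fin N) (𝕜 := ℂ)
  have h1 : star (T A) * T A = 1 := by
    refine (ContinuousLinearMap.norm_map_iff_adjoint_comp_self (T A)).1 fun x => ?_
    refine (sq_eq_sq₀ (norm_nonneg _) (norm_nonneg _)).1 ?_
    rw [EuclideanSpace.norm_sq_eq, EuclideanSpace.norm_sq_eq]
    exact h x.ofLp
  rw [← map_star, ← map_mul, ← map_one T] at h1
  exact T.injective h1

/-- A bijective isometric graded map is given by a relabeling and unitary matrices. -/
theorem IsContractiveRep.exists_relabeling (hB : IsContractiveRep θ τ B)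
    (hB' : IsContractiveRep τ θ B') (h : B * B' = 1) (h' : B' * B = 1)
    (hn : ∀ i, 1 ≤ n i) (hm : ∀ j, 1 ≤ m j) :
    ∃ (R : Relabeling n m) (A : ∀ i, Matrix.unitaryGroup (Fin (n i)) ℂ),
      ∀ i k, linOp τ (B ⟨i, k⟩) = rotatedShift τ R A i k := by
  classical
  obtain ⟨σ, hσ, hσ'⟩ := hB.exists_equiv hB' h h' hn hm
  have hB0 : ∀ {i : Fin r} {j : Fin s} (k : Fin (n i)) (l : Fin (m j)), j ≠ σ i →
      B ⟨i, k⟩ ⟨j, l⟩ = 0 := fun k l hj => by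
    by_contra h0
    exact hj (hσ _ _ h0)
  have hB0' : ∀ {i : Fin r} {j : Fin s} (l : Fin (m j)) (k : Fin (n i)), j ≠ σ i →
      B' ⟨j, l⟩ ⟨i, k⟩ = 0 := fun l k hj => by
    by_contra h0
    exact hj (hσ' _ _ h0)
  have hcard : ∀ i, n i = m (σ i) := fun i => by
    let C : Matrix (Fin (n i)) (Fin (m (σ i))) ℂ := .of fun k l => B ⟨i, k⟩ ⟨σ i, l⟩
    let C' : Matrix (Fin (m (σ i))) (Fin (n i)) ℂ := .of fun l k => B' ⟨σ i, l⟩ ⟨i, k⟩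
    have e1 : C * C' = 1 := by
      ext k k'
      have e := congrFun (congrFun h ⟨i, k⟩) ⟨i, k'⟩
      rw [Matrix.mul_apply, Fintype.sum_sigma, Finset.sum_eq_single (σ i)] at e
      · simpa [Matrix.mul_apply, C, C', Matrix.one_apply] using e
      · intro j _ hj
        simp [hB0 _ _ hj]
      · simp
    have e2 : C' * C = 1 := by
      ext k k'
      have e := congrFun (congrFun h' ⟨σ i, k⟩) ⟨σ i, k'⟩
      rw [Matrix.mul_apply, Fintype.sum_sigma, Finset.sum_eq_single i] at e
      · simpa [Matrix.mul_apply, C, C', Matrix.one_apply] using e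
      · intro j _ hj
        simp [hB0' k _ (σ.injective.ne hj.symm)]
      · simp
    have := (Matrix.toLin'OfInv e1 e2).finrank_eq
    simpa using this
  let ι : ∀ i, Fin (n i) ≃ Fin (m (σ i)) := fun i => finCongr (hcard i)
  let A : ∀ i, Matrix (Fin (n i)) (Fin (n i)) ℂ := fun i => .of fun k l => B ⟨i, k⟩ ⟨σ i, ι i l⟩
  -- Every vector supported in block `σ i` is a point, and on vectors supported in one block the
  -- maximum norm is the Euclidean norm. Isometry of `B` on points therefore makes `A i` a Euclidean
  -- isometry.
  have hA : ∀ i, A i ∈ Matrix.unitaryGroup (Fin (n i)) ℂ := fun i => by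
    refine mem_unitaryGroup_of_norm_mulVec fun a => ?_
    let α : Gen m → ℂ := fun g => if h : g.1 = σ i then a ((ι i).symm (h ▸ g.2)) else 0
    have hα0 : ∀ g, g.1 ≠ σ i → α g = 0 := fun g hg => dif_neg hg
    have hα1 : ∀ l, α ⟨σ i, l⟩ = a ((ι i).symm l) := fun l => by simp [α]
    have hBα : ∀ i' k, (B *ᵥ α) ⟨i', k⟩ = ∑ l, B ⟨i', k⟩ ⟨σ i, l⟩ * a ((ι i).symm l) :=
      fun i' k => by
        rw [Matrix.mulVec, dotProduct, Fintype.sum_sigma, Finset.sum_eq_single (σ i)]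
        · simp only [hα1]
        · intro j _ hj
          exact Finset.sum_eq_zero fun l _ => by rw [hα0 ⟨j, l⟩ hj, mul_zero]
        · simp
    have hnorm : ∀ {q : ℕ} {p : Fin q → ℕ} (β : Gen p → ℂ) (b : Fin q)
        (_ : ∀ g, g.1 ≠ b → β g = 0), ‖blocks p β‖ ^ 2 = ∑ k, ‖β ⟨b, k⟩‖ ^ 2 := by
      intro q p β b hβ
      rw [← norm_blocks_sq]
      congr 1
      refine le_antisymm ((pi_norm_le_iff_of_nonneg (norm_nonneg _)).2 fun c => ?_)
        (norm_le_pi_norm _ b)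
      by_cases hc : c = b
      · rw [hc]
      · have : blocks p β c = 0 := by
          ext k
          exact hβ ⟨c, k⟩ hc
        rw [this, norm_zero]
        exact norm_nonneg _
    have e := hB.norm_blocks_eq hB' h' (isPoint_of_support (θ := τ) hα0)
    have e2 : ‖blocks n (B *ᵥ α)‖ ^ 2 = ‖blocks m α‖ ^ 2 := by rw [e]
    rw [hnorm α (σ i) hα0, hnorm (B *ᵥ α) i fun g hg => by
      rw [hBα]
      exact Finset.sum_eq_zero fun l _ => by
        rw [hB0 _ _ (σ.injective.ne hg).symm, zero_mul]] at e2
    simp only [hBα, hα1] at e2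
    rw [(ι i).symm.sum_comp fun l => ‖a l‖ ^ 2] at e2
    rw [← e2]
    refine Finset.sum_congr rfl fun k _ => ?_
    rw [← (ι i).sum_comp]
    simp [Matrix.mulVec, dotProduct, A]
  refine ⟨⟨σ, ι⟩, fun i => ⟨A i, hA i⟩, fun i k => ?_⟩
  rw [linOp, Fintype.sum_sigma, Finset.sum_eq_single (σ i), ← (ι i).sum_comp]
  · rfl
  · intro j _ hj
    exact Finset.sum_eq_zero fun l _ => by simp [hB0 k l hj]
  · simp

end Relabeling

/-! ### Construction of the implementing unitary -/

section Unitary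

variable {r s : ℕ} {n : Fin r → ℕ} {m : Fin s → ℕ} {θ : PermSet n} {τ : PermSet m}
  [IsLeftCancelMul (Semi τ)]
  {R : Relabeling n m} {A : ∀ i, Matrix.unitaryGroup (Fin (n i)) ℂ}

/-- If the rotated shifts satisfy the relations of `θ`, then the permutation sets are product
unitarily equivalent. -/
theorem implementsProductEquiv_of_rotatedShift_mul
    (h : ∀ (i j : Fin r) (h : i < j) (k : Fin (n i)) (l : Fin (n j)),
      rotatedShift τ R A i k * rotatedShift τ R A j l =
        rotatedShift τ R A j (θ i j h (k, l)).2 * rotatedShift τ R A i (θ i j h (k, l)).1) :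
    ImplementsProductEquiv θ (τ.relabel R) A := by
  rw [implementsProductEquiv_iff]
  intro i j hij x y
  -- The products `e p` are distinct by cancelation, so coefficients can be compared once both sides
  -- are rewritten with the letter of block `σ j` first.
  let e : Fin (n i) × Fin (n j) → Semi τ := fun p =>
    gen τ (R.σ j) (R.ι j p.2) * gen τ (R.σ i) (R.ι i p.1)
  have he : Function.Injective e := by
    rintro ⟨a, b⟩ ⟨a', b'⟩ hab
    obtain ⟨h1, h2⟩ := gen_mul_eq_gen_mul_iff.1 hab
    have h3 := gen_inj.1 h2
    simp only [Sigma.mk.injEq, heq_eq_eq, true_and] at h3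
    exact Prod.ext ((R.ι i).injective h3) ((R.ι j).injective h1)
  have hl : (rotatedShift τ R A i x.1 * rotatedShift τ R A j x.2) (ξ 1) =
      ∑ p : Fin (n i) × Fin (n j), ((A i).1 x.1 p.1 * (A j).1 x.2 p.2) •
        ξ (e (τ.relabel R i j hij p)) := by
    rw [rotatedShift, rotatedShift, Finset.sum_mul_sum, ← Fintype.sum_prod_type', sum_apply]
    refine Finset.sum_congr rfl fun p _ => ?_
    rw [smul_mul_smul_comm, ← shift_mul, gen_mul_gen_relabel τ R hij, smul_apply, shift_ξ, mul_one]
  have hr : (rotatedShift τ R A j (θ i j hij x).2 * rotatedShift τ R A i (θ i j hij x).1) (ξ 1) =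
      ∑ p : Fin (n i) × Fin (n j),
        ((A i).1 (θ i j hij x).1 p.1 * (A j).1 (θ i j hij x).2 p.2) • ξ (e p) := by
    rw [rotatedShift, rotatedShift, Finset.sum_mul_sum, Finset.sum_comm, ← Fintype.sum_prod_type',
      sum_apply]
    refine Finset.sum_congr rfl fun p _ => ?_
    rw [smul_mul_smul_comm, ← shift_mul, smul_apply, shift_ξ, mul_one, mul_comm ((A j).1 _ _)]
  have h1 := h i j hij x.1 x.2
  have h2 := congrArg (fun B => (B (ξ 1)) (e (τ.relabel R i j hij y))) h1
  simp only [Prod.mk.eta, hl, hr, lp.coeFn_sum, Finset.sum_apply, lp.coeFn_smul, Pi.smul_apply,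
    smul_eq_mul] at h2
  rw [Finset.sum_eq_single y, Finset.sum_eq_single (τ.relabel R i j hij y), ξ_apply_self,
    mul_one, mul_one] at h2
  · exact h2
  · intro p _ hp
    rw [ξ_apply_of_ne (he.ne hp), mul_zero]
  · simp
  · intro p _ hp
    rw [ξ_apply_of_ne (he.ne ((τ.relabel R i j hij).injective.ne hp)), mul_zero]
  · simp

theorem inner_rotatedShift (i : Fin r) (k l : Fin (n i)) (x y : Fock (Semi τ)) :
    inner ℂ (rotatedShift τ R A i k x) (rotatedShift τ R A i l y) =
      if k = l then inner ℂ x y else 0 := by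
  have hA : (A i).1 * (A i).1ᴴ = 1 := Matrix.mem_unitaryGroup_iff.1 (A i).2
  have h : ∀ a b, inner ℂ (shift (gen τ (R.σ i) (R.ι i a)) x)
      (shift (gen τ (R.σ i) (R.ι i b)) y) = if a = b then inner ℂ x y else 0 := fun a b => by
    split_ifs with hab
    · subst hab
      exact inner_shift_shift_self _ _ _
    · exact inner_shift_shift_of_forall_ne
        (fun w w' => gen_mul_ne_gen_mul ((R.ι i).injective.ne hab) w w') x y
  have h2 : ∑ a, (A i).1 l a * star ((A i).1 k a) = if k = l then 1 else 0 := by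
    have := congrFun (congrFun hA l) k
    rw [Matrix.mul_apply, Matrix.one_apply] at this
    simpa [eq_comm] using this
  rw [rotatedShift, rotatedShift, sum_apply, sum_apply, sum_inner]
  simp only [inner_sum, smul_apply, inner_smul_left, inner_smul_right, h, mul_ite, mul_zero,
    Finset.sum_ite_eq, Finset.mem_univ, if_true]
  calc _ = ∑ a, ((A i).1 l a * star ((A i).1 k a)) * inner ℂ x y :=
        Finset.sum_congr rfl fun a _ => by rw [starRingEnd_apply]; ring
    _ = if k = l then inner ℂ x y else 0 := by
        rw [← Finset.sum_mul, h2, ite_mul, one_mul, zero_mul]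

theorem mdeg_eq_of_rotatedHom_apply_ne_zero (hA : ImplementsProductEquiv θ (τ.relabel R) A)
    {x : Semi θ} {v : Semi τ} (h : rotatedHom hA x (ξ 1) v ≠ 0) (i : Fin r) :
    mdeg v (R.σ i) = mdeg x i := by
  induction x using semi_induction generalizing v with
  | one =>
    have : v = 1 := by
      by_contra hv
      rw [map_one, one_apply_eq_self, ξ_apply_of_ne (Ne.symm hv)] at h
      exact h rfl
    rw [this, mdeg_one, mdeg_one]
    rfl
  | gen_mul j k x ih =>
    rw [map_mul, rotatedHom_gen, mul_apply_eq_comp, rotatedShift, sum_apply, lp.coeFn_sum,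
      Finset.sum_apply] at h
    obtain ⟨l, -, hl⟩ := Finset.exists_ne_zero_of_sum_ne_zero h
    rw [smul_apply, lp.coeFn_smul, Pi.smul_apply] at hl
    have hl := right_ne_zero_of_smul hl
    obtain ⟨u, rfl⟩ : ∃ u, gen τ (R.σ j) (R.ι j l) * u = v := by
      by_contra! hu
      exact hl (shift_apply_of_forall_ne hu _)
    rw [shift_apply_mul] at hl
    rw [mdeg_mul, mdeg_mul, Pi.add_apply, Pi.add_apply, ih hl, mdeg_gen, mdeg_gen]
    simp [Pi.single_apply]

variable [IsLeftCancelMul (Semi θ)]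

/-- Different multi-degrees give disjoint supports. In equal multi-degree both elements can be made
to start with a letter of the same block, and `inner_rotatedShift` reduces the inner product to the
remaining factors. -/
theorem orthonormal_rotatedHom (hA : ImplementsProductEquiv θ (τ.relabel R) A) :
    Orthonormal ℂ fun x : Semi θ => rotatedHom hA x (ξ 1) := by
  classical
  rw [orthonormal_iff_ite]
  intro x y
  by_cases hxy : mdeg x = mdeg y
  · induction x using semi_induction generalizing y with
    | one =>
      have : y = 1 := eq_one_of_tdeg_eq_zero (by rw [tdeg, ← hxy]; exact tdeg_one)
      rw [this, map_one, one_apply_eq_self, inner_self_eq_norm_sq_to_K,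
        orthonormal_ξ.1]
      simp
    | gen_mul i k x ih =>
      obtain ⟨l, y, rfl⟩ := exists_eq_gen_mul (x := y) (i := i) (by
        rw [← hxy, mdeg_mul, mdeg_gen]; simp)
      rw [mdeg_mul, mdeg_mul, mdeg_gen, mdeg_gen] at hxy
      rw [map_mul, map_mul, rotatedHom_gen, rotatedHom_gen, mul_apply_eq_comp, mul_apply_eq_comp,
        inner_rotatedShift, ih y (add_left_cancel hxy)]
      simp only [gen_mul_eq_gen_mul_iff]
      split_ifs <;> simp_all
  · rw [if_neg fun h => hxy (congrArg mdeg h), lp.inner_eq_tsum]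
    refine (tsum_congr fun v => ?_).trans tsum_zero
    by_cases h1 : rotatedHom hA x (ξ 1) v = 0
    · rw [h1, inner_zero_left]
    by_cases h2 : rotatedHom hA y (ξ 1) v = 0
    · rw [h2, inner_zero_right]
    refine absurd ?_ hxy
    funext i
    rw [← mdeg_eq_of_rotatedHom_apply_ne_zero hA h1, mdeg_eq_of_rotatedHom_apply_ne_zero hA h2]

-- Generating shifts are combinations of rotated shifts, so this span is invariant under them; it
-- contains the vacuum.
omit [IsLeftCancelMul (Semi θ)] in
theorem ξ_mem_span_rotatedHom (hA : ImplementsProductEquiv θ (τ.relabel R) A) (v : Semi τ) :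
    ξ v ∈ Submodule.span ℂ (Set.range fun x : Semi θ => rotatedHom hA x (ξ 1)) := by
  induction v using semi_induction with
  | one => exact Submodule.subset_span ⟨1, by simp⟩
  | gen_mul j l v ih =>
    obtain ⟨i, rfl⟩ := R.σ.surjective j
    obtain ⟨l, rfl⟩ := (R.ι i).surjective l
    rw [← shift_ξ]
    have h : ∀ z ∈ Submodule.span ℂ (Set.range fun x : Semi θ => rotatedHom hA x (ξ 1)),
        shift (gen τ (R.σ i) (R.ι i l)) z ∈
          Submodule.span ℂ (Set.range fun x : Semi θ => rotatedHom hA x (ξ 1)) := by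
      intro z hz
      induction hz using Submodule.span_induction with
      | mem z hz =>
        obtain ⟨x, rfl⟩ := hz
        rw [← sum_star_smul_rotatedShift, sum_apply]
        refine sum_mem fun k _ => ?_
        refine Submodule.smul_mem _ _ (Submodule.subset_span ⟨gen θ i k * x, ?_⟩)
        simp only [map_mul, rotatedHom_gen]
        rfl
      | zero => rw [map_zero]; exact zero_mem _
      | add a b _ _ ha hb => rw [map_add]; exact add_mem ha hb
      | smul c a _ ha => rw [map_smul]; exact Submodule.smul_mem _ _ ha
    exact h _ ih

/-- The unitary operator `ξ_x ↦ ρ(x) ξ_1`, where `ρ` is the representation by products of rotated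
shifts. -/
theorem exists_unitary_rotatedHom (hA : ImplementsProductEquiv θ (τ.relabel R) A) :
    ∃ U : Fock (Semi θ) ≃ₗᵢ[ℂ] Fock (Semi τ), ∀ x, U (ξ x) = rotatedHom hA x (ξ 1) := by
  classical
  have hsp : ⊤ ≤ (Submodule.span ℂ
      (Set.range fun x : Semi θ => rotatedHom hA x (ξ 1))).topologicalClosure := by
    intro y _
    exact mem_of_ξ_mem _ (Submodule.isClosed_topologicalClosure _)
      (fun v => Submodule.le_topologicalClosure _ (ξ_mem_span_rotatedHom hA v)) y
  let b := HilbertBasis.mk (orthonormal_rotatedHom hA) hsp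
  refine ⟨b.repr.symm, fun x => ?_⟩
  have h := b.repr_symm_single x
  have e : (ξ x : Fock (Semi θ)) = lp.single 2 x (1 : ℂ) := by unfold ξ; congr!
  rw [e]
  exact h.trans (congrFun (HilbertBasis.coe_mk _ _) x)

/-- A bijective isometric graded map is implemented by a unitary operator `U_{A₁, …, A_r}`. -/
theorem IsContractiveRep.productUnitarilyImplemented
    {B : Matrix (Gen n) (Gen m) ℂ} {B' : Matrix (Gen m) (Gen n) ℂ} (hB : IsContractiveRep θ τ B)
    (hB' : IsContractiveRep τ θ B') (h : B * B' = 1) (h' : B' * B = 1)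
    (hn : ∀ i, 1 ≤ n i) (hm : ∀ j, 1 ≤ m j) : ProductUnitarilyImplemented θ τ := by
  obtain ⟨R, A, hRA⟩ := hB.exists_relabeling hB' h h' hn hm
  have hA : ImplementsProductEquiv θ (τ.relabel R) A :=
    implementsProductEquiv_of_rotatedShift_mul fun i j h k l => by
      simpa only [hRA] using hB.rel i j h k l
  obtain ⟨U, hU⟩ := exists_unitary_rotatedHom hA
  refine ⟨R, A, hA, U, (isProductUnitary_iff hA).2 hU, ?_⟩
  rw [← map_wotAlg_eq hA hU]
  rfl

end Unitary

/-! ### WOT continuous linear maps of operators -/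

section WOTContinuous

variable {H : Type} [NormedAddCommGroup H] [InnerProductSpace ℂ H]

/-- A linear map of operators is WOT continuous. -/
def WOTContinuous (F : (H →L[ℂ] H) →ₗ[ℂ] (H →L[ℂ] H)) : Prop :=
  Continuous fun Y : H →WOT[ℂ] H => ContinuousLinearMapWOT.ofCLM (F Y.toCLM)

theorem wotContinuous_id : WOTContinuous (LinearMap.id : (H →L[ℂ] H) →ₗ[ℂ] (H →L[ℂ] H)) :=
  continuous_id

theorem wotContinuous_mulLeftRight (A B : H →L[ℂ] H) :
    WOTContinuous (LinearMap.mulLeftRight ℂ (A, B)) :=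
  continuous_wot_comp_comp A B

theorem wotContinuous_mulLeft (A : H →L[ℂ] H) : WOTContinuous (LinearMap.mulLeft ℂ A) :=
  continuous_wot_comp_comp A (1 : H →L[ℂ] H)

theorem wotContinuous_mulRight (A : H →L[ℂ] H) : WOTContinuous (LinearMap.mulRight ℂ A) :=
  continuous_wot_comp_comp (1 : H →L[ℂ] H) A

variable {F G : (H →L[ℂ] H) →ₗ[ℂ] (H →L[ℂ] H)}

theorem WOTContinuous.comp (hF : WOTContinuous F) (hG : WOTContinuous G) :
    WOTContinuous (F ∘ₗ G) := by
  have h : Continuous ((fun Y : H →WOT[ℂ] H => ContinuousLinearMapWOT.ofCLM (F Y.toCLM)) ∘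
      fun Y : H →WOT[ℂ] H => ContinuousLinearMapWOT.ofCLM (G Y.toCLM)) := Continuous.comp hF hG
  exact h

theorem WOTContinuous.sub (hF : WOTContinuous F) (hG : WOTContinuous G) :
    WOTContinuous (F - G) :=
  Continuous.sub hF hG

theorem WOTContinuous.smul (hF : WOTContinuous F) (c : ℂ) : WOTContinuous (c • F) :=
  Continuous.const_smul hF c

theorem wotContinuous_sum {ι : Type*} (s : Finset ι) {F : ι → (H →L[ℂ] H) →ₗ[ℂ] (H →L[ℂ] H)}
    (h : ∀ i, WOTContinuous (F i)) : WOTContinuous (∑ i ∈ s, F i) := by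
  classical
  induction s using Finset.induction with
  | empty => exact continuous_const (y := (0 : H →WOT[ℂ] H))
  | insert a s ha ih =>
    rw [Finset.sum_insert ha]
    exact Continuous.add (h a) ih

theorem WOTContinuous.isWOTClosed_comap (hF : WOTContinuous F) {B : Submodule ℂ (H →L[ℂ] H)}
    (hB : IsWOTClosed (B : Set (H →L[ℂ] H))) :
    IsWOTClosed (B.comap F : Set (H →L[ℂ] H)) :=
  hB.preimage hF

theorem WOTContinuous.isWOTClosed_ker (hF : WOTContinuous F) :
    IsWOTClosed (F.ker : Set (H →L[ℂ] H)) := by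
  have h0 : IsWOTClosed ({0} : Set (H →L[ℂ] H)) := by
    have : {Y : H →WOT[ℂ] H | Y.toCLM ∈ ({0} : Set (H →L[ℂ] H))} = {0} := by
      ext Y
      exact ContinuousLinearMapWOT.toCLM_injective.eq_iff (b := 0)
    rw [IsWOTClosed, this]
    exact isClosed_singleton
  exact h0.preimage hF

end WOTContinuous

/-! ### Gauge unitaries and averages over roots of unity -/

section Gauge

variable {r : ℕ} {n : Fin r → ℕ} {θ : PermSet n}

theorem orthonormal_gauge (i : Fin r) (z : Circle) :
    Orthonormal ℂ fun w : Semi θ => (z : ℂ) ^ mdeg w i • (ξ w : Fock (Semi θ)) := by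
  refine ⟨fun w => ?_, fun v w hvw => ?_⟩
  · rw [norm_smul, orthonormal_ξ.1, mul_one, norm_pow, Circle.norm_coe, one_pow]
  · simp [inner_smul_left, inner_smul_right, inner_ξ, ξ_apply_of_ne hvw.symm]

/-- The gauge unitary `ξ_w ↦ z^{p_i(w)} ξ_w`, where `p_i(w)` is the degree of `w` in the `i`-th
generators. -/
def gauge (θ : PermSet n) (i : Fin r) (z : Circle) : Fock (Semi θ) →L[ℂ] Fock (Semi θ) :=
  (ofOrthonormal (orthonormal_gauge (θ := θ) i z)).toContinuousLinearMap

theorem gauge_ξ (i : Fin r) (z : Circle) (w : Semi θ) :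
    gauge θ i z (ξ w) = (z : ℂ) ^ mdeg w i • ξ w :=
  ofOrthonormal_ξ (orthonormal_gauge (θ := θ) i z) w

theorem norm_gauge_le (i : Fin r) (z : Circle) : ‖gauge θ i z‖ ≤ 1 :=
  LinearIsometry.norm_toContinuousLinearMap_le _

/-- A primitive root of unity on the circle. -/
def rootOfUnity (M : ℕ) : Circle := Circle.exp (2 * Real.pi / M)

theorem sum_rootOfUnity_pow {M : ℕ} (hM : M ≠ 0) (d : ℕ) :
    (M : ℂ)⁻¹ * ∑ j ∈ Finset.range M, ((rootOfUnity M ^ j : Circle) : ℂ) ^ d =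
      if M ∣ d then 1 else 0 := by
  have hζ : IsPrimitiveRoot (rootOfUnity M : ℂ) M := by
    have := Complex.isPrimitiveRoot_exp M hM
    rw [rootOfUnity, Circle.coe_exp]
    convert this using 2
    push_cast
    ring
  have hM' : (M : ℂ) ≠ 0 := Nat.cast_ne_zero.2 hM
  have h : ∀ j : ℕ, ((rootOfUnity M ^ j : Circle) : ℂ) ^ d = ((rootOfUnity M : ℂ) ^ d) ^ j :=
    fun j => by rw [Circle.coe_pow, ← pow_mul, ← pow_mul, mul_comm]
  simp only [h]
  split_ifs with hd
  · rw [(hζ.pow_eq_one_iff_dvd d).2 hd]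
    simp [hM']
  · have h1 : (rootOfUnity M : ℂ) ^ d - 1 ≠ 0 := fun e =>
      hd ((hζ.pow_eq_one_iff_dvd d).1 (sub_eq_zero.1 e))
    have h2 := geom_sum_mul ((rootOfUnity M : ℂ) ^ d) M
    rw [← pow_mul, mul_comm d M, pow_mul, hζ.pow_eq_one, one_pow, sub_self] at h2
    rw [(mul_eq_zero.1 h2).resolve_right h1, mul_zero]

/-- The average of the gauge unitaries over the `M`-th roots of unity. -/
def gaugeProj (θ : PermSet n) (i : Fin r) (M : ℕ) : Fock (Semi θ) →L[ℂ] Fock (Semi θ) :=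
  (M : ℂ)⁻¹ • ∑ j ∈ Finset.range M, gauge θ i (rootOfUnity M ^ j)

theorem gaugeProj_ξ (i : Fin r) {M : ℕ} (hM : M ≠ 0) (w : Semi θ) :
    gaugeProj θ i M (ξ w) = if M ∣ mdeg w i then ξ w else 0 := by
  have := sum_rootOfUnity_pow hM (mdeg w i)
  rw [gaugeProj, smul_apply, sum_apply]
  simp only [gauge_ξ]
  rw [← Finset.sum_smul, smul_smul, this, ite_smul, one_smul, zero_smul]

theorem gaugeProj_apply (i : Fin r) {M : ℕ} (hM : M ≠ 0) (x : Fock (Semi θ)) (v : Semi θ) :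
    gaugeProj θ i M x v = if M ∣ mdeg v i then x v else 0 := by
  have h : (innerSL ℂ (ξ v : Fock (Semi θ))) ∘L gaugeProj θ i M =
      (if M ∣ mdeg v i then 1 else 0 : ℂ) • innerSL ℂ (ξ v : Fock (Semi θ)) := by
    refine clm_ext fun w => ?_
    rw [ContinuousLinearMap.comp_apply, gaugeProj_ξ i hM]
    by_cases hvw : v = w
    · subst hvw
      split_ifs <;> simp
    · have : (ξ w : Fock (Semi θ)) v = 0 := ξ_apply_of_ne (Ne.symm hvw)
      split_ifs <;> simp [innerSL_apply_apply, inner_ξ, this]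
  have := congrArg (fun A => A x) h
  simp only [ContinuousLinearMap.comp_apply, innerSL_apply_apply, inner_ξ, smul_apply,
    smul_eq_mul] at this
  rw [this]
  split_ifs <;> simp

theorem norm_inv_smul_sum_le {E : Type*} [NormedAddCommGroup E] [NormedSpace ℂ E] {C : ℝ}
    (hC : 0 ≤ C) (M : ℕ) {f : ℕ → E} (hf : ∀ j, ‖f j‖ ≤ C) :
    ‖(M : ℂ)⁻¹ • ∑ j ∈ Finset.range M, f j‖ ≤ C := by
  rcases Nat.eq_zero_or_pos M with rfl | hM
  · simpa using hC
  have hM' : (0 : ℝ) < M := Nat.cast_pos.2 hM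
  rw [norm_smul, norm_inv, Complex.norm_natCast, inv_mul_le_iff₀ hM']
  refine (norm_sum_le_of_le _ fun j _ => hf j).trans ?_
  simp

theorem norm_gaugeProj_le (i : Fin r) (M : ℕ) : ‖gaugeProj θ i M‖ ≤ 1 :=
  norm_inv_smul_sum_le zero_le_one M fun _ => norm_gauge_le i _

/-- The average of the conjugates of an operator by gauge unitaries. -/
def gaugeAvg (θ : PermSet n) (i : Fin r) (M : ℕ) :
    (Fock (Semi θ) →L[ℂ] Fock (Semi θ)) →ₗ[ℂ] (Fock (Semi θ) →L[ℂ] Fock (Semi θ)) :=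
  (M : ℂ)⁻¹ • ∑ j ∈ Finset.range M,
    LinearMap.mulLeftRight ℂ (gauge θ i (rootOfUnity M ^ j), gauge θ i (rootOfUnity M ^ j)⁻¹)

theorem wotContinuous_gaugeAvg (i : Fin r) (M : ℕ) : WOTContinuous (gaugeAvg θ i M) :=
  (wotContinuous_sum _ fun _ => wotContinuous_mulLeftRight _ _).smul _

theorem gaugeAvg_apply (i : Fin r) (M : ℕ) (T : Fock (Semi θ) →L[ℂ] Fock (Semi θ)) :
    gaugeAvg θ i M T = (M : ℂ)⁻¹ • ∑ j ∈ Finset.range M,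
      gauge θ i (rootOfUnity M ^ j) * T * gauge θ i (rootOfUnity M ^ j)⁻¹ := by
  simp [gaugeAvg]

theorem norm_gaugeAvg_le (i : Fin r) (M : ℕ) (T : Fock (Semi θ) →L[ℂ] Fock (Semi θ)) :
    ‖gaugeAvg θ i M T‖ ≤ ‖T‖ := by
  rw [gaugeAvg_apply]
  refine norm_inv_smul_sum_le (norm_nonneg T) M fun j => ?_
  calc ‖gauge θ i (rootOfUnity M ^ j) * T * gauge θ i (rootOfUnity M ^ j)⁻¹‖
      ≤ ‖gauge θ i (rootOfUnity M ^ j)‖ * ‖T‖ * ‖gauge θ i (rootOfUnity M ^ j)⁻¹‖ :=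
        norm_mul₃_le
    _ ≤ 1 * ‖T‖ * 1 := by gcongr <;> exact norm_gauge_le i _
    _ = ‖T‖ := by ring

theorem gaugeAvg_apply_ξ_one (i : Fin r) (M : ℕ) (T : Fock (Semi θ) →L[ℂ] Fock (Semi θ)) :
    gaugeAvg θ i M T (ξ 1) = gaugeProj θ i M (T (ξ 1)) := by
  rw [gaugeAvg_apply, gaugeProj, smul_apply, smul_apply, sum_apply, sum_apply]
  simp [gauge_ξ, mdeg_one]

variable [IsLeftCancelMul (Semi θ)]

theorem gaugeAvg_shift (i : Fin r) {M : ℕ} (hM : M ≠ 0) (v : Semi θ) :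
    gaugeAvg θ i M (shift v) = if M ∣ mdeg v i then shift v else 0 := by
  have h : ∀ z : Circle, gauge θ i z * shift v * gauge θ i z⁻¹ =
      (z : ℂ) ^ mdeg v i • shift v := fun z => by
    refine clm_ext fun w => ?_
    have hz : (z : ℂ) ≠ 0 := z.coe_ne_zero
    simp only [mul_apply_eq_comp, gauge_ξ, map_smul, shift_ξ, smul_apply, smul_smul, mdeg_mul,
      Pi.add_apply, Circle.coe_inv]
    congr 1
    rw [pow_add, mul_comm, mul_assoc, ← mul_pow, mul_inv_cancel₀ hz, one_pow, mul_one]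
  have := sum_rootOfUnity_pow hM (mdeg v i)
  rw [gaugeAvg_apply]
  simp only [h]
  rw [← Finset.sum_smul, smul_smul, this, ite_smul, one_smul, zero_smul]

theorem gaugeAvg_mem_wotAlg (i : Fin r) {M : ℕ} (hM : M ≠ 0)
    {T : Fock (Semi θ) →L[ℂ] Fock (Semi θ)} (hT : T ∈ wotAlg (Semi θ)) :
    gaugeAvg θ i M T ∈ wotAlg (Semi θ) := by
  refine wotAlg_le_submodule (M := (Subalgebra.toSubmodule (wotAlg (Semi θ))).comap
    (gaugeAvg θ i M)) (fun v => ?_)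
    ((wotContinuous_gaugeAvg i M).isWOTClosed_comap isWOTClosed_wotAlg) hT
  rw [Submodule.mem_comap, gaugeAvg_shift i hM]
  split_ifs
  · exact shift_mem_wotAlg v
  · exact zero_mem _

theorem adjoint_shift_gen_mul_shift_mem_wotAlg {i : Fin r} (k : Fin (n i)) {v : Semi θ}
    (hv : mdeg v i ≠ 0) : ContinuousLinearMap.adjoint (shift (gen θ i k)) * shift v ∈
      wotAlg (Semi θ) := by
  obtain ⟨l, y, rfl⟩ := exists_eq_gen_mul hv
  rw [shift_mul, ← mul_assoc]
  by_cases hkl : k = l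
  · subst hkl
    rw [adjoint_shift_mul_shift_self, one_mul]
    exact shift_mem_wotAlg y
  · rw [adjoint_shift_mul_shift_of_forall_ne fun w w' => gen_mul_ne_gen_mul hkl w w', zero_mul]
    exact zero_mem _

/-- By linearity and WOT closedness it suffices to treat shifts `L_v`. The difference kills those
with `M ∣ mdeg v i`; the others have positive degree in block `i`, and the adjoint either strips a
first letter or annihilates them. -/
theorem adjoint_mul_sub_gaugeAvg_mem_wotAlg {i : Fin r} (k : Fin (n i)) {M : ℕ} (hM : M ≠ 0)
    {T : Fock (Semi θ) →L[ℂ] Fock (Semi θ)} (hT : T ∈ wotAlg (Semi θ)) :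
    ContinuousLinearMap.adjoint (shift (gen θ i k)) * (T - gaugeAvg θ i M T) ∈
      wotAlg (Semi θ) := by
  refine wotAlg_le_submodule (M := (Subalgebra.toSubmodule (wotAlg (Semi θ))).comap
    (LinearMap.mulLeft ℂ (ContinuousLinearMap.adjoint (shift (gen θ i k))) ∘ₗ
      (LinearMap.id - gaugeAvg θ i M))) (fun v => ?_)
    (((wotContinuous_mulLeft _).comp
      (wotContinuous_id.sub (wotContinuous_gaugeAvg i M))).isWOTClosed_comap
        isWOTClosed_wotAlg) hT
  change ContinuousLinearMap.adjoint (shift (gen θ i k)) * (shift v - gaugeAvg θ i M (shift v)) ∈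
    wotAlg (Semi θ)
  rw [gaugeAvg_shift i hM]
  split_ifs with hd
  · rw [sub_self, mul_zero]
    exact zero_mem _
  · rw [sub_zero]
    exact adjoint_shift_gen_mul_shift_mem_wotAlg k fun h => hd (by rw [h]; exact dvd_zero M)

theorem sum_shift_mul_adjoint_mul_shift {i : Fin r} {v : Semi θ} (hv : mdeg v i ≠ 0) :
    ∑ k, shift (gen θ i k) * (ContinuousLinearMap.adjoint (shift (gen θ i k)) * shift v) =
      shift v := by
  obtain ⟨l, y, rfl⟩ := exists_eq_gen_mul hv
  rw [Finset.sum_eq_single l]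
  · rw [shift_mul, ← mul_assoc (ContinuousLinearMap.adjoint _), adjoint_shift_mul_shift_self,
      one_mul]
  · intro k _ hkl
    rw [shift_mul, ← mul_assoc (ContinuousLinearMap.adjoint _),
      adjoint_shift_mul_shift_of_forall_ne fun w w' => gen_mul_ne_gen_mul hkl w w', zero_mul,
      mul_zero]
  · simp

/-- The operator `∑_k L_k L_k*` fixes every shift of positive degree in block `i`, hence everything
left after removing the gauge average. -/
theorem sub_gaugeAvg_eq {i : Fin r} {M : ℕ} (hM : M ≠ 0)
    {T : Fock (Semi θ) →L[ℂ] Fock (Semi θ)} (hT : T ∈ wotAlg (Semi θ)) :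
    T - gaugeAvg θ i M T = ∑ k, shift (gen θ i k) *
      (ContinuousLinearMap.adjoint (shift (gen θ i k)) * (T - gaugeAvg θ i M T)) := by
  let P : (Fock (Semi θ) →L[ℂ] Fock (Semi θ)) →ₗ[ℂ] (Fock (Semi θ) →L[ℂ] Fock (Semi θ)) :=
    ∑ k, LinearMap.mulLeft ℂ (shift (gen θ i k)) ∘ₗ
      LinearMap.mulLeft ℂ (ContinuousLinearMap.adjoint (shift (gen θ i k)))
  have hP : ∀ X, P X = ∑ k, shift (gen θ i k) *
      (ContinuousLinearMap.adjoint (shift (gen θ i k)) * X) := fun X => by simp [P]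
  have hPc : WOTContinuous P :=
    wotContinuous_sum _ fun _ => (wotContinuous_mulLeft _).comp (wotContinuous_mulLeft _)
  have h := wotAlg_le_submodule
    (M := ((LinearMap.id - P) ∘ₗ (LinearMap.id - gaugeAvg θ i M)).ker) (fun v => ?_)
    ((wotContinuous_id.sub hPc).comp
      (wotContinuous_id.sub (wotContinuous_gaugeAvg i M))).isWOTClosed_ker hT
  · rw [← hP]
    exact sub_eq_zero.1 (LinearMap.mem_ker.1 h)
  · rw [LinearMap.mem_ker]
    change (shift v - gaugeAvg θ i M (shift v)) - P (shift v - gaugeAvg θ i M (shift v)) = 0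
    rw [gaugeAvg_shift i hM]
    split_ifs with hd
    · simp
    · rw [sub_zero, hP, sum_shift_mul_adjoint_mul_shift, sub_self]
      exact fun h => hd (by rw [h]; exact dvd_zero M)

section GenIdeal

/-- The sums `∑_e L_e Y_e` over all generators `e`, with coefficients `Y_e` in `B`. -/
def genIdeal (B : Subalgebra ℂ (Fock (Semi θ) →L[ℂ] Fock (Semi θ))) :
    Submodule ℂ (Fock (Semi θ) →L[ℂ] Fock (Semi θ)) where
  carrier := {X | ∃ Y : Gen n → Fock (Semi θ) →L[ℂ] Fock (Semi θ), (∀ g, Y g ∈ B) ∧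
    X = ∑ g, shift (gen θ g.1 g.2) * Y g}
  add_mem' := by
    rintro _ _ ⟨Y, hY, rfl⟩ ⟨Z, hZ, rfl⟩
    exact ⟨Y + Z, fun g => add_mem (hY g) (hZ g), by
      simp [mul_add, Finset.sum_add_distrib]⟩
  zero_mem' := ⟨0, fun _ => zero_mem _, by simp⟩
  smul_mem' := by
    rintro c _ ⟨Y, hY, rfl⟩
    exact ⟨c • Y, fun g => B.smul_mem (hY g) c, by simp [Finset.smul_sum]⟩

theorem shift_gen_mul_mem_genIdeal
    {B : Subalgebra ℂ (Fock (Semi θ) →L[ℂ] Fock (Semi θ))} (i : Fin r) (k : Fin (n i))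
    {Y : Fock (Semi θ) →L[ℂ] Fock (Semi θ)} (hY : Y ∈ B) :
    shift (gen θ i k) * Y ∈ genIdeal B := by
  classical
  refine ⟨Pi.single ⟨i, k⟩ Y, fun g => ?_, ?_⟩
  · by_cases hg : g = ⟨i, k⟩
    · rw [hg, Pi.single_eq_same]; exact hY
    · rw [Pi.single_eq_of_ne hg]; exact zero_mem _
  · rw [Finset.sum_eq_single (⟨i, k⟩ : Gen n)]
    · simp
    · intro g _ hg
      rw [Pi.single_eq_of_ne hg, mul_zero]
    · simp

end GenIdeal

end Gauge

/-! ### Exact decomposition of operators in the WOT closed algebra -/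

section Decomposition

variable {r : ℕ} {n : Fin r → ℕ} {θ : PermSet n} [IsCancelMul (Semi θ)]

theorem mul_rightShift_of_mem_wotAlg {T : Fock (Semi θ) →L[ℂ] Fock (Semi θ)}
    (hT : T ∈ wotAlg (Semi θ)) (w : Semi θ) : T * rightShift w = rightShift w * T := by
  have h := wotAlg_le_submodule
    (M := (LinearMap.mulRight ℂ (rightShift w) - LinearMap.mulLeft ℂ (rightShift w)).ker)
    (fun v => by
      rw [LinearMap.mem_ker, LinearMap.sub_apply, LinearMap.mulRight_apply,
        LinearMap.mulLeft_apply, shift_mul_rightShift, sub_self])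
    ((wotContinuous_mulRight _).sub (wotContinuous_mulLeft _)).isWOTClosed_ker hT
  exact sub_eq_zero.1 (LinearMap.mem_ker.1 h)

/-- Operators in `𝔏_θ` commute with right shifts, so they are determined by the image of the vacuum.
Right cancelation enters here, through the isometric right shifts. -/
theorem apply_ξ_of_mem_wotAlg {T : Fock (Semi θ) →L[ℂ] Fock (Semi θ)}
    (hT : T ∈ wotAlg (Semi θ)) (w : Semi θ) : T (ξ w) = rightShift w (T (ξ 1)) := by
  have := congrArg (fun A => A (ξ 1)) (mul_rightShift_of_mem_wotAlg hT w)
  simpa [rightShift_ξ] using this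

/-- Splitting off the part of an operator in `𝔏_θ` that has positive degree in the `i`-th
generators. -/
theorem exists_gauge_split (i : Fin r) {T : Fock (Semi θ) →L[ℂ] Fock (Semi θ)}
    (hT : T ∈ wotAlg (Semi θ)) : ∃ T' ∈ wotAlg (Semi θ),
      ∃ Y : Fin (n i) → Fock (Semi θ) →L[ℂ] Fock (Semi θ), (∀ k, Y k ∈ wotAlg (Semi θ)) ∧
        T = T' + ∑ k, shift (gen θ i k) * Y k ∧
        ∀ v, T' (ξ 1) v = if mdeg v i = 0 then T (ξ 1) v else 0 := by
  -- The index `N + 1` avoids the empty average. Averaging keeps the degrees divisible by `N + 1`,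
  -- and for large `N` a given degree survives only if it is 0.
  let A : ℕ → Fock (Semi θ) →L[ℂ] Fock (Semi θ) := fun N => gaugeAvg θ i (N + 1) T
  have hA : ∀ N, A N ∈ wotAlg (Semi θ) := fun N => gaugeAvg_mem_wotAlg i N.succ_ne_zero hT
  have hproj : ∀ x : Fock (Semi θ), ∃ y, Filter.Tendsto (fun N => gaugeProj θ i (N + 1) x)
      Filter.atTop (nhds y) := by
    refine exists_tendsto_of_forall_ξ _ (fun N => norm_gaugeProj_le i (N + 1)) fun w => ?_
    refine ⟨if mdeg w i = 0 then ξ w else 0, tendsto_const_nhds.congr' ?_⟩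
    filter_upwards [Filter.eventually_ge_atTop (mdeg w i)] with N hN
    rw [gaugeProj_ξ i N.succ_ne_zero]
    by_cases h0 : mdeg w i = 0
    · simp [h0]
    · have : ¬ (N + 1) ∣ mdeg w i := Nat.not_dvd_of_pos_of_lt (Nat.pos_of_ne_zero h0) (by omega)
      simp [h0, this]
  -- The averages are uniformly bounded, and right shifts transport convergence from the vacuum to
  -- every basis vector.
  have hlim : ∀ x, ∃ y, Filter.Tendsto (fun N => A N x) Filter.atTop (nhds y) := by
    refine exists_tendsto_of_forall_ξ _ (fun N => norm_gaugeAvg_le i (N + 1) T) fun w => ?_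
    obtain ⟨y, hy⟩ := hproj (T (ξ 1))
    refine ⟨rightShift w y, (((rightShift w).continuous.tendsto y).comp hy).congr fun N => ?_⟩
    rw [Function.comp_apply, apply_ξ_of_mem_wotAlg (hA N), gaugeAvg_apply_ξ_one]
  choose f hf using hlim
  let T' : Fock (Semi θ) →L[ℂ] Fock (Semi θ) :=
    continuousLinearMapOfTendsto A (tendsto_pi_nhds.2 hf)
  have hT' : ∀ x, Filter.Tendsto (fun N => A N x) Filter.atTop (nhds (T' x)) := hf
  have hsub : ∀ x, Filter.Tendsto (fun N => (T - A N) x) Filter.atTop (nhds ((T - T') x)) :=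
    fun x => tendsto_const_nhds.sub (hT' x)
  refine ⟨T', isWOTClosed_wotAlg.mem_of_tendsto hA hT',
    fun k => ContinuousLinearMap.adjoint (shift (gen θ i k)) * (T - T'), fun k => ?_, ?_, ?_⟩
  · refine isWOTClosed_wotAlg.mem_of_tendsto
      (fun N => adjoint_mul_sub_gaugeAvg_mem_wotAlg k N.succ_ne_zero hT) fun x => ?_
    exact ((ContinuousLinearMap.adjoint (shift (gen θ i k))).continuous.tendsto _).comp (hsub x)
  · rw [← sub_eq_iff_eq_add']
    ext1 x
    refine tendsto_nhds_unique (hsub x) ?_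
    have h1 : ∀ N, (T - A N) x = ∑ k, shift (gen θ i k)
        (ContinuousLinearMap.adjoint (shift (gen θ i k)) ((T - A N) x)) := fun N => by
      have := congrArg (fun B => B x) (sub_gaugeAvg_eq (i := i) N.succ_ne_zero hT)
      simpa only [sum_apply, mul_apply_eq_comp] using this
    rw [sum_apply]
    refine (tendsto_finsetSum _ fun k _ => ?_).congr fun N => (h1 N).symm
    exact (((shift (gen θ i k)).continuous.comp
      (ContinuousLinearMap.adjoint (shift (gen θ i k))).continuous).tendsto _).comp (hsub x)
  · intro v
    have h1 : Filter.Tendsto (fun N => A N (ξ 1) v) Filter.atTop (nhds (T' (ξ 1) v)) := by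
      have := ((innerSL ℂ (ξ v : Fock (Semi θ))).continuous.tendsto _).comp (hT' (ξ 1))
      simpa only [Function.comp_def, innerSL_apply_apply, inner_ξ] using this
    refine tendsto_nhds_unique h1 (tendsto_const_nhds.congr' ?_)
    filter_upwards [Filter.eventually_ge_atTop (mdeg v i)] with N hN
    rw [gaugeAvg_apply_ξ_one, gaugeProj_apply i N.succ_ne_zero]
    by_cases h0 : mdeg v i = 0
    · simp [h0]
    · have : ¬ (N + 1) ∣ mdeg v i := Nat.not_dvd_of_pos_of_lt (Nat.pos_of_ne_zero h0) (by omega)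
      simp [h0, this]

/-- Every operator in `𝔏_θ` is the sum of a scalar and an operator `∑_e L_e Y_e` with
coefficients in `𝔏_θ`. -/
theorem exists_smul_one_add_mem_genIdeal {T : Fock (Semi θ) →L[ℂ] Fock (Semi θ)}
    (hT : T ∈ wotAlg (Semi θ)) : ∃ c : ℂ, T - c • 1 ∈ genIdeal (wotAlg (Semi θ)) := by
  classical
  -- Positive degrees are removed one block at a time. Once all blocks are treated, the vacuum is an
  -- eigenvector of the remainder, which is therefore a scalar.
  have key : ∀ t : Finset (Fin r), ∃ T' ∈ wotAlg (Semi θ), T - T' ∈ genIdeal (wotAlg (Semi θ)) ∧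
      ∀ i ∈ t, ∀ v, mdeg v i ≠ 0 → T' (ξ 1) v = 0 := by
    intro t
    induction t using Finset.induction with
    | empty => exact ⟨T, hT, by rw [sub_self]; exact zero_mem _, by simp⟩
    | insert i t _ ih =>
      obtain ⟨T₁, hT₁, h1, h2⟩ := ih
      obtain ⟨T₂, hT₂, Y, hY, h3, h4⟩ := exists_gauge_split i hT₁
      refine ⟨T₂, hT₂, ?_, fun j hj v hv => ?_⟩
      · have : T - T₂ = (T - T₁) + ∑ k, shift (gen θ i k) * Y k := by
          rw [h3]
          abel
        rw [this]
        exact add_mem h1 (sum_mem fun k _ => shift_gen_mul_mem_genIdeal i k (hY k))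
      · rw [h4]
        split_ifs with h0
        · rcases Finset.mem_insert.1 hj with rfl | hj
          · exact absurd h0 hv
          · exact h2 j hj v hv
        · rfl
  obtain ⟨T', hT', h1, h2⟩ := key Finset.univ
  have h3 : T' (ξ 1) = T' (ξ 1) 1 • ξ 1 := by
    ext v
    rw [lp.coeFn_smul, Pi.smul_apply, smul_eq_mul]
    by_cases hv : v = 1
    · rw [hv, ξ_apply_self, mul_one]
    · rw [ξ_apply_of_ne (Ne.symm hv), mul_zero]
      have : tdeg v ≠ 0 := fun h => hv (eq_one_of_tdeg_eq_zero h)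
      obtain ⟨i, -, hi⟩ := Finset.exists_ne_zero_of_sum_ne_zero this
      exact h2 i (Finset.mem_univ i) v hi
  have h4 : T' = T' (ξ 1) 1 • 1 := clm_ext fun w => by
    rw [apply_ξ_of_mem_wotAlg hT', h3, map_smul, rightShift_ξ, one_mul, ← h3]
    rfl
  exact ⟨T' (ξ 1) 1, by rw [← h4]; exact h1⟩

end Decomposition

/-! ### Linear combinations of generators and the polynomial algebra -/

section Generators

variable {r : ℕ} {n : Fin r → ℕ} {θ : PermSet n} [IsLeftCancelMul (Semi θ)]

theorem shift_gen_apply_gen (g h : Gen n) (x : Fock (Semi θ)) :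
    shift (gen θ h.1 h.2) x (gen θ g.1 g.2) = if h = g then x 1 else 0 := by
  split_ifs with hgh
  · subst hgh
    simpa using shift_apply_mul (gen θ h.1 h.2) 1 x
  · refine shift_apply_of_forall_ne (fun w hw => hgh ?_) x
    have h1 := congrArg tdeg hw
    rw [tdeg_mul, tdeg_gen, tdeg_gen] at h1
    rw [eq_one_of_tdeg_eq_zero (x := w) (by omega), mul_one] at hw
    exact gen_inj.1 hw

theorem linOp_apply_gen (y : Gen n → ℂ) (x : Fock (Semi θ)) (g : Gen n) :
    linOp θ y x (gen θ g.1 g.2) = y g * x 1 := by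
  rw [linOp, sum_apply, lp.coeFn_sum, Finset.sum_apply]
  simp only [smul_apply, lp.coeFn_smul, Pi.smul_apply, shift_gen_apply_gen, smul_eq_mul]
  simp

theorem linOp_injective : Function.Injective (linOp θ) := fun y z h => by
  funext g
  have := congrArg (fun A => (A (ξ 1)) (gen θ g.1 g.2)) h
  simpa only [linOp_apply_gen, ξ_apply_self, mul_one] using this

theorem mem_span_shift_gen_iff {X : Fock (Semi θ) →L[ℂ] Fock (Semi θ)} :
    X ∈ Submodule.span ℂ {Y | ∃ (j : Fin r) (l : Fin (n j)), Y = shift (gen θ j l)} ↔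
      ∃ y, linOp θ y = X := by
  have h : {Y | ∃ (j : Fin r) (l : Fin (n j)), Y = shift (gen θ j l)} =
      Set.range fun g : Gen n => shift (gen θ g.1 g.2) := by
    ext Y
    simp [eq_comm]
  rw [h, Submodule.mem_span_range_iff_exists_fun]
  rfl

theorem linOp_mem {B : Subalgebra ℂ (Fock (Semi θ) →L[ℂ] Fock (Semi θ))}
    (hB : polyAlg (Semi θ) ≤ B) (c : Gen n → ℂ) : linOp θ c ∈ B :=
  sum_mem fun _ _ => B.smul_mem (hB (shift_mem_polyAlg _)) _

theorem genIdeal_mono {B C : Subalgebra ℂ (Fock (Semi θ) →L[ℂ] Fock (Semi θ))} (h : B ≤ C) :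
    genIdeal B ≤ genIdeal C := by
  rintro _ ⟨Y, hY, rfl⟩
  exact ⟨Y, fun g => h (hY g), rfl⟩

theorem exists_smul_one_add_mem_genIdeal_polyAlg {T : Fock (Semi θ) →L[ℂ] Fock (Semi θ)}
    (hT : T ∈ polyAlg (Semi θ)) : ∃ c : ℂ, T - c • 1 ∈ genIdeal (polyAlg (Semi θ)) := by
  have hT' : T ∈ Subalgebra.toSubmodule (polyAlg (Semi θ)) := hT
  clear hT
  rw [polyAlg, adjoin_range_shift] at hT'
  induction hT' using Submodule.span_induction with
  | mem T hT =>
    obtain ⟨v, rfl⟩ := hT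
    by_cases hv : tdeg v = 0
    · exact ⟨1, by
        rw [eq_one_of_tdeg_eq_zero hv, shift_one, one_smul, sub_self]; exact zero_mem _⟩
    · obtain ⟨i, k, y, rfl⟩ := exists_eq_gen_mul_of_tdeg_ne_zero hv
      refine ⟨0, ?_⟩
      rw [zero_smul, sub_zero, shift_mul]
      exact shift_gen_mul_mem_genIdeal i k (shift_mem_polyAlg y)
  | zero => exact ⟨0, by simp⟩
  | add S T _ _ hS hT =>
    obtain ⟨c, hc⟩ := hS
    obtain ⟨d, hd⟩ := hT
    refine ⟨c + d, ?_⟩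
    convert add_mem hc hd using 1
    rw [add_smul]
    abel
  | smul a T _ hT =>
    obtain ⟨c, hc⟩ := hT
    refine ⟨a * c, ?_⟩
    rw [mul_smul, ← smul_sub]
    exact Submodule.smul_mem _ a hc

end Generators

/-! ### The matrix of a graded isomorphism and its inverse -/

section GradedIsomorphism

variable {r s : ℕ} {n : Fin r → ℕ} {m : Fin s → ℕ} {θ : PermSet n} {τ : PermSet m}
  [IsLeftCancelMul (Semi θ)] [IsLeftCancelMul (Semi τ)]
  {B : Subalgebra ℂ (Fock (Semi θ) →L[ℂ] Fock (Semi θ))}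
  {C : Subalgebra ℂ (Fock (Semi τ) →L[ℂ] Fock (Semi τ))}

/-- The matrix `M` describes the homomorphism `Φ` on the generating isometries. -/
def IsMatrixOf (hB : polyAlg (Semi θ) ≤ B) (Φ : B →ₐ[ℂ] C) (M : Matrix (Gen n) (Gen m) ℂ) : Prop :=
  ∀ g : Gen n, (Φ ⟨shift (gen θ g.1 g.2), hB (shift_mem_polyAlg _)⟩ :
    Fock (Semi τ) →L[ℂ] Fock (Semi τ)) = linOp τ (M g)

theorem IsGraded.exists_isMatrixOf (hB : polyAlg (Semi θ) ≤ B) {Φ : B →ₐ[ℂ] C}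
    (hΦ : IsGraded Φ) : ∃ M, IsMatrixOf hB Φ M := by
  have h : ∀ g : Gen n, ∃ y, linOp τ y =
      (Φ ⟨shift (gen θ g.1 g.2), hB (shift_mem_polyAlg _)⟩ :
        Fock (Semi τ) →L[ℂ] Fock (Semi τ)) := fun g =>
    mem_span_shift_gen_iff.1 (hΦ g.1 g.2 _ rfl)
  choose M hM using h
  exact ⟨M, fun g => (hM g).symm⟩

variable {hB : polyAlg (Semi θ) ≤ B} {hC : polyAlg (Semi τ) ≤ C} {Φ : B →ₐ[ℂ] C}
  {M : Matrix (Gen n) (Gen m) ℂ}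

theorem IsMatrixOf.map_linOp (hM : IsMatrixOf hB Φ M) (c : Gen n → ℂ) :
    (Φ ⟨linOp θ c, linOp_mem hB c⟩ : Fock (Semi τ) →L[ℂ] Fock (Semi τ)) = linOp τ (c ᵥ* M) := by
  have h1 : (⟨linOp θ c, linOp_mem hB c⟩ : B) =
      ∑ g, c g • ⟨shift (gen θ g.1 g.2), hB (shift_mem_polyAlg _)⟩ := by
    ext1
    simp [linOp]
  rw [h1, map_sum]
  simp only [map_smul, AddSubmonoidClass.coe_finsetSum, Subalgebra.coe_smul]
  rw [Finset.sum_congr rfl fun g _ => congrArg (c g • ·) (hM g)]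
  simp only [linOp, Finset.smul_sum, smul_smul]
  rw [Finset.sum_comm]
  refine Finset.sum_congr rfl fun g' _ => ?_
  rw [← Finset.sum_smul]
  rfl

theorem IsMatrixOf.isContractiveRep (hM : IsMatrixOf hB Φ M) (hΦ : ∀ X, ‖Φ X‖ = ‖X‖) :
    IsContractiveRep θ τ M where
  rel i j h k l := by
    have hmul : ∀ g g' : Gen n, linOp τ (M g) * linOp τ (M g') =
        (Φ ⟨shift (gen θ g.1 g.2 * gen θ g'.1 g'.2), hB (shift_mem_polyAlg _)⟩ :
          Fock (Semi τ) →L[ℂ] Fock (Semi τ)) := fun g g' => by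
      rw [← hM g, ← hM g', ← Subalgebra.coe_mul, ← map_mul]
      congr 2
      ext1
      exact (shift_mul _ _).symm
    rw [hmul, hmul]
    congr 2
    ext1
    exact congrArg shift (gen_mul_gen_of_lt θ h k l)
  norm_le c := by
    rw [← hM.map_linOp c]
    exact (hΦ ⟨linOp θ c, linOp_mem hB c⟩).le

/-- The degree one part of the image of an operator with vanishing constant term. -/
theorem IsMatrixOf.exists_vecMul_eq (hM : IsMatrixOf hB Φ M) (X : B) {c : ℂ}
    (hX : (X : Fock (Semi θ) →L[ℂ] Fock (Semi θ)) - c • 1 ∈ genIdeal B) :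
    ∃ y : Gen n → ℂ, ∀ g : Gen m,
      (Φ X : Fock (Semi τ) →L[ℂ] Fock (Semi τ)) (ξ 1) (gen τ g.1 g.2) = (y ᵥ* M) g := by
  obtain ⟨Y, hY, hXY⟩ := hX
  have h1 : X = c • 1 + ∑ e, ⟨shift (gen θ e.1 e.2), hB (shift_mem_polyAlg _)⟩ * ⟨Y e, hY e⟩ := by
    ext1
    rw [sub_eq_iff_eq_add'] at hXY
    simpa using hXY
  -- `Φ (L_e)` is homogeneous of degree one, so only the constant term of `Φ (Y_e)` reaches degree
  -- one in the product.
  refine ⟨fun e => (Φ ⟨Y e, hY e⟩ : Fock (Semi τ) →L[ℂ] Fock (Semi τ)) (ξ 1) 1, fun g => ?_⟩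
  rw [h1, map_add, map_sum, map_smul, map_one]
  simp only [map_mul, Subalgebra.coe_add, Subalgebra.coe_smul, Subalgebra.coe_one,
    AddSubmonoidClass.coe_finsetSum, Subalgebra.coe_mul]
  rw [Finset.sum_congr rfl fun e _ => congrArg (· * _) (hM e)]
  have h2 : (ξ 1 : Fock (Semi τ)) (gen τ g.1 g.2) = 0 := ξ_apply_of_ne fun h => by
    have := congrArg tdeg h
    rw [tdeg_one, tdeg_gen] at this
    omega
  rw [add_apply, lp.coeFn_add, Pi.add_apply, smul_apply, lp.coeFn_smul, Pi.smul_apply,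
    one_apply_eq_self, h2, smul_zero, zero_add, sum_apply, lp.coeFn_sum, Finset.sum_apply]
  refine Finset.sum_congr rfl fun e _ => ?_
  rw [mul_apply_eq_comp, linOp_apply_gen, mul_comm]

/-- Applied to the preimage of a generating shift, the hypothesis puts the corresponding unit vector
in the row space of `M`, so that shift is already the image of a combination of generators;
injectivity identifies the preimage. -/
theorem isGraded_symm {Φ : B ≃ₐ[ℂ] C} (hM : IsMatrixOf hB Φ.toAlgHom M)
    (h : ∀ X : B, ∃ y : Gen n → ℂ, ∀ g : Gen m,
      (Φ X : Fock (Semi τ) →L[ℂ] Fock (Semi τ)) (ξ 1) (gen τ g.1 g.2) = (y ᵥ* M) g) :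
    IsGraded Φ.symm.toAlgHom := by
  classical
  intro j l X hX
  obtain ⟨y, hy⟩ := h (Φ.symm X)
  rw [mem_span_shift_gen_iff]
  refine ⟨y, ?_⟩
  have h1 : y ᵥ* M = Pi.single ⟨j, l⟩ 1 := by
    funext g
    rw [← hy g, Φ.apply_symm_apply, hX, shift_gen_apply_gen g ⟨j, l⟩, ξ_apply_self,
      Pi.single_apply]
    simp only [eq_comm]
  have h2 : Φ ⟨linOp θ y, linOp_mem hB y⟩ = X := by
    ext1
    have := hM.map_linOp y
    rw [h1, linOp_single] at this
    exact this.trans hX.symm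
  change _ = ((Φ.symm X : B) : Fock (Semi θ) →L[ℂ] Fock (Semi θ))
  rw [← h2, Φ.symm_apply_apply]

theorem IsMatrixOf.mul_eq_one {Ψ : C →ₐ[ℂ] B} {M' : Matrix (Gen m) (Gen n) ℂ}
    (hM : IsMatrixOf hB Φ M) (hM' : IsMatrixOf hC Ψ M') (h : ∀ X, Ψ (Φ X) = X) : M * M' = 1 := by
  classical
  refine funext fun g => ?_
  refine linOp_injective (θ := θ) ?_
  have h1 : (M * M') g = M g ᵥ* M' := rfl
  have h2 : (1 : Matrix (Gen n) (Gen n) ℂ) g = Pi.single g 1 := by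
    funext g'
    rw [Matrix.one_apply, Pi.single_apply]
    simp only [eq_comm]
  rw [h1, h2, ← hM'.map_linOp, linOp_single]
  have h3 : (⟨linOp τ (M g), linOp_mem hC (M g)⟩ : C) =
      Φ ⟨shift (gen θ g.1 g.2), hB (shift_mem_polyAlg _)⟩ := by
    ext1
    exact (hM g).symm
  rw [h3, h]

/-- The hypothesis `h` isolates the only step that depends on which closure is taken. -/
theorem productUnitarilyImplemented_of_isometry (hB : polyAlg (Semi θ) ≤ B)
    (hC : polyAlg (Semi τ) ≤ C) (hn : ∀ i, 1 ≤ n i) (hm : ∀ j, 1 ≤ m j) {Φ : B ≃ₐ[ℂ] C}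
    (hΦ : Isometry Φ) (hgr : IsGraded Φ.toAlgHom)
    (h : ∀ M, IsMatrixOf hB Φ.toAlgHom M → ∀ X : B, ∃ y : Gen n → ℂ, ∀ g : Gen m,
      (Φ X : Fock (Semi τ) →L[ℂ] Fock (Semi τ)) (ξ 1) (gen τ g.1 g.2) = (y ᵥ* M) g) :
    ProductUnitarilyImplemented θ τ := by
  have hnorm : ∀ X, ‖Φ X‖ = ‖X‖ := fun X => hΦ.norm_map_of_map_zero (map_zero Φ) X
  obtain ⟨M, hM⟩ := hgr.exists_isMatrixOf hB
  obtain ⟨M', hM'⟩ := (isGraded_symm hM (h M hM)).exists_isMatrixOf hC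
  refine (hM.isContractiveRep hnorm).productUnitarilyImplemented
    (hM'.isContractiveRep fun X => ?_) (hM.mul_eq_one hM' Φ.symm_apply_apply)
    (hM'.mul_eq_one hM Φ.apply_symm_apply) hn hm
  rw [← hnorm]
  exact congrArg norm (Φ.apply_symm_apply X)

end GradedIsomorphism

/-! ### The two kinds of closure -/

section Main

variable {r s : ℕ} {n : Fin r → ℕ} {m : Fin s → ℕ} {θ : PermSet n} {τ : PermSet m}

theorem productUnitarilyImplemented_of_normAlg [IsLeftCancelMul (Semi θ)]
    [IsLeftCancelMul (Semi τ)] (hn : ∀ i, 1 ≤ n i) (hm : ∀ j, 1 ≤ m j)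
    (h : GradedlyIsometricallyIsomorphic (normAlg (Semi θ)) (normAlg (Semi τ))) :
    ProductUnitarilyImplemented θ τ := by
  obtain ⟨Φ, hΦ, hgr⟩ := h
  refine productUnitarilyImplemented_of_isometry polyAlg_le_normAlg polyAlg_le_normAlg hn hm
    hΦ hgr fun M hM X => ?_
  let D : normAlg (Semi θ) → Gen m → ℂ := fun X g =>
    (Φ X : Fock (Semi τ) →L[ℂ] Fock (Semi τ)) (ξ 1) (gen τ g.1 g.2)
  have hD : Continuous D := by
    refine continuous_pi fun g => ?_
    have h1 : Continuous fun X : normAlg (Semi θ) =>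
        (Φ X : Fock (Semi τ) →L[ℂ] Fock (Semi τ)) (ξ 1) :=
      (continuous_subtype_val.comp hΦ.continuous).clm_apply continuous_const
    simpa only [Function.comp_def, innerSL_apply_apply, inner_ξ] using
      (innerSL ℂ (ξ (gen τ g.1 g.2) : Fock (Semi τ))).continuous.comp h1
  have hW : IsClosed (M.vecMulLinear.range : Set (Gen m → ℂ)) :=
    Submodule.closed_of_finiteDimensional _
  obtain ⟨x, hx, hxX⟩ := mem_closure_iff_seq_limit.1 X.2
  have hxX' : Filter.Tendsto (fun N => (⟨x N, polyAlg_le_normAlg (hx N)⟩ : normAlg (Semi θ)))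
      Filter.atTop (nhds X) := tendsto_subtype_rng.2 hxX
  -- The row space of `M` is finite dimensional, hence closed, and degree one parts depend
  -- continuously on `X`, so polynomials suffice.
  have hmem : D X ∈ M.vecMulLinear.range := by
    refine hW.mem_of_tendsto ((hD.tendsto X).comp hxX') (Filter.Eventually.of_forall fun N => ?_)
    obtain ⟨c, hc⟩ := exists_smul_one_add_mem_genIdeal_polyAlg (hx N)
    obtain ⟨y, hy⟩ := hM.exists_vecMul_eq ⟨x N, polyAlg_le_normAlg (hx N)⟩
      (genIdeal_mono polyAlg_le_normAlg hc)
    exact ⟨y, funext fun g => (hy g).symm⟩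
  obtain ⟨y, hy⟩ := hmem
  exact ⟨y, fun g => (congrFun hy g).symm⟩

theorem productUnitarilyImplemented_of_wotAlg [IsCancelMul (Semi θ)]
    [IsLeftCancelMul (Semi τ)] (hn : ∀ i, 1 ≤ n i) (hm : ∀ j, 1 ≤ m j)
    (h : GradedlyIsometricallyIsomorphic (wotAlg (Semi θ)) (wotAlg (Semi τ))) :
    ProductUnitarilyImplemented θ τ := by
  obtain ⟨Φ, hΦ, hgr⟩ := h
  refine productUnitarilyImplemented_of_isometry polyAlg_le_wotAlg polyAlg_le_wotAlg hn hm
    hΦ hgr fun M hM X => ?_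
  obtain ⟨c, hc⟩ := exists_smul_one_add_mem_genIdeal X.2
  exact hM.exists_vecMul_eq X hc

end Main

end HigherRankToeplitz

end

theorem theorem7p1 {r s : ℕ} {n : Fin r → ℕ} {m : Fin s → ℕ}
    (hn : ∀ i, 1 ≤ n i) (hm : ∀ j, 1 ≤ m j)
    (θ : HigherRankToeplitz.PermSet n) (τ : HigherRankToeplitz.PermSet m)
    [HigherRankToeplitz.Cancelative θ] [HigherRankToeplitz.Cancelative τ] :
    List.TFAE [
      HigherRankToeplitz.GradedlyIsometricallyIsomorphic
        (HigherRankToeplitz.normAlg (HigherRankToeplitz.Semi θ))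
        (HigherRankToeplitz.normAlg (HigherRankToeplitz.Semi τ)),
      HigherRankToeplitz.MultigradedlyIsometricallyIsomorphic
        (HigherRankToeplitz.normAlg (HigherRankToeplitz.Semi θ))
        (HigherRankToeplitz.normAlg (HigherRankToeplitz.Semi τ)),
      HigherRankToeplitz.GradedlyIsometricallyIsomorphic
        (HigherRankToeplitz.wotAlg (HigherRankToeplitz.Semi θ))
        (HigherRankToeplitz.wotAlg (HigherRankToeplitz.Semi τ)),
      HigherRankToeplitz.MultigradedlyIsometricallyIsomorphic
        (HigherRankToeplitz.wotAlg (HigherRankToeplitz.Semi θ))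
        (HigherRankToeplitz.wotAlg (HigherRankToeplitz.Semi τ)),
      HigherRankToeplitz.ProductUnitarilyImplemented θ τ] := by
  tfae_have 2 → 1 := fun ⟨Φ, hΦ, h⟩ => ⟨Φ, hΦ, h.1⟩
  tfae_have 4 → 3 := fun ⟨Φ, hΦ, h⟩ => ⟨Φ, hΦ, h.1⟩
  tfae_have 1 → 5 := HigherRankToeplitz.productUnitarilyImplemented_of_normAlg hn hm
  tfae_have 3 → 5 := HigherRankToeplitz.productUnitarilyImplemented_of_wotAlg hn hm
  tfae_have 5 → 2 := by
    -- The clause on the image of `𝔏_θ` can be dropped: the product equivalence and the formula for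
    -- `U` already imply it, and they give the norm closed case as well.
    rintro ⟨R, A, hA, U, hU, -⟩
    have hU := (HigherRankToeplitz.isProductUnitary_iff hA).1 hU
    exact HigherRankToeplitz.multigradedlyIsometricallyIsomorphic_of_map_eq hA hU
      (HigherRankToeplitz.map_normAlg_eq hA hU)
  tfae_have 5 → 4 := by
    rintro ⟨R, A, hA, U, hU, -⟩
    have hU := (HigherRankToeplitz.isProductUnitary_iff hA).1 hU
    exact HigherRankToeplitz.multigradedlyIsometricallyIsomorphic_of_map_eq hA hU
      (HigherRankToeplitz.map_wotAlg_eq hA hU)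
  tfae_finish
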